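/- **Setting.** Let $\mathcal L=\{\mathbf f,\mathbf u,\mathbf t\}$ with the truth order $\mathbf f\le\mathbf u\le\mathbf t$ and negation ${\sim}\mathbf t=\mathbf f$, ${\sim}\mathbf f=\mathbf t$, ${\sim}\mathbf u=\mathbf u$. A *fact space* is a set $\mathcal F\supseteq\mathcal L$ with an involution ${\sim}$ extending the negation of $\mathcal L$ such that ${\sim}x\ne x$ for $x\neq\mathbf u$. For $A\subseteq\mathcal F$ put ${\sim}A=\{{\sim}a: a\in A\}$. A *justification frame* consists of a set $\mathcal F_d\subseteq\mathcal F\setminus\mathcal L$ of *defined* facts, closed under ${\sim}$ (the other facts are *open*), and a set $R$ of rules $x\leftarrow A$ with $x\in\mathcal F_d$ and $\emptyset\ne A\subseteq\mathcal F$, such that every $x\in\mathcal F_d$ has at least one rule. A selection function for $x$ is a map $s$ with $s(A)\in A$ for every rule $x\leftarrow A$, and $\mathrm{Im}(s)=\{s(A): (x\leftarrow A)\in R\}$. The frame is *complementary* if 1. it is fixed under complementation: for every $x\in\mathcal F_d$ and every selection function $s$ for $x$, the rule ${\sim}x\leftarrow{\sim}\mathrm{Im}(s)$ is in $R$; and 2.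 the rules for $x$ and ${\sim}x$ are opposed: $A\cap{\sim}B\ne\emptyset$ whenever $x\leftarrow A$ and ${\sim}x\leftarrow B$ are in $R$. A *branch* is an infinite sequence in $\mathcal F_d$, or a finite non-empty sequence in $\mathcal F_d$ followed by an open fact; ${\sim}b$ is obtained from a branch $b$ by applying ${\sim}$ to each element. A *branch evaluation* $\mathcal B$ maps branches to facts; it is *consistent* if $\mathcal B({\sim}b)={\sim}\mathcal B(b)$ for all $b$. An *interpretation* is a map $\mathcal I:\mathcal F\to\mathcal L$ with $\mathcal I({\sim}x)={\sim}\mathcal I(x)$ that is the identity on $\mathcal L$. A *finite path* is a (possibly empty) finite sequence of defined facts in which each next element occurs in the body of some rule for the previous one. A *loop* at $x$ is a non-empty finite path $q$ starting in $x$ such that $q\to x$ is a path. For a set $M$ of loops at $x$, $M^*$ and $M^\omega$ are the sets of finite (possibly empty) and infinite concatenations of members of $M$. With respect to $\mathcal I$, the branch evaluation $\mathcal B$ is * *monotone* if for all branches $b_1,b_2$ starting in the same fact $x$ and all finite paths $p$ such that $p\to x$ is a path, $\mathcal I(\mathcal B(b_1))\le\mathcal I(\mathcal B(b_2))$ implies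 $\mathcal I(\mathcal B(p\to b_1))\le\mathcal I(\mathcal B(p\to b_2))$; * *selective* if for all $x\in\mathcal F_d$, all finite paths $p$ such that $p\to x$ is a path, all sets $M,N$ of loops at $x$, all sets $K$ of branches starting in $x$, and every $b\in p(M\cup N)^*K\cup p(M\cup N)^\omega$, there are $b_*,b^*\in pM^\omega\cup pN^\omega\cup pK$ with $\mathcal I(\mathcal B(b_*))\le\mathcal I(\mathcal B(b))\le\mathcal I(\mathcal B(b^*))$. A *justification* is a directed graph with nodes labelled by facts such that for every node $n$ with an outgoing edge, the rule whose head is the label of $n$ and whose body is the set of labels of the children of $n$ is in $R$. It is *graph-like* if no two nodes have the same label, *tree-like* if its underlying undirected graph is acyclic, and *locally complete* if no leaf has a defined label. For $x\in\mathcal F_d$ and a locally complete justification $J$ with a node labelled $x$, let $\mathrm{val}(J,x,\mathcal I)=\bigwedge_b\mathcal I(\mathcal B(b))$, where $b$ ranges over the label sequences of the paths in $J$ that start in a node labelled $x$ and are infinite or end in a leaf. The *graph-like supported value* $\mathrm{SV}_g(x,\mathcal I)$ (resp. *tree-like supported value* $\mathrm{SV}_t(x,\mathcal I)$) of $x\in\mathcal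 F_d$ is the least upper bound of $\mathrm{val}(J,x,\mathcal I)$ over all locally complete graph-like (resp. tree-like) justifications $J$ with a node labelled $x$; for open $x$ both are $\mathcal I(x)$. **Corollary.** Let $\mathcal F$ be finite, let the justification frame be complementary, let $\mathcal B$ be a consistent branch evaluation, and let $\mathcal I$ be an interpretation with respect to which $\mathcal B$ is monotone and selective. Then $$\mathrm{SV}_g({\sim}x,\mathcal I)={\sim}\,\mathrm{SV}_g(x,\mathcal I)\quad\text{for all }x\in\mathcal F_d,\qquad\text{and}\qquad \mathrm{SV}_g(x,\mathcal I)=\mathrm{SV}_t(x,\mathcal I)\quad\text{for all }x\in\mathcal F.$$ In particular, if $\mathcal B$ is monotone and selective with respect to every interpretation, this holds for all interpretations $\mathcal I$. -/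

import Mathlib

universe u

/-- The three logical values: false, unknown, true. -/
inductive Truth : Type
  | fls
  | unk
  | tru

namespace Truth

/-- Position in the truth order `fls < unk < tru`. -/
def rank : Truth → ℕ
  | fls => 0
  | unk => 1
  | tru => 2

theorem rank_injective : Function.Injective rank := by
  intro a b h
  cases a <;> cases b <;> simp_all [rank]

/-- The truth order `fls ≤ unk ≤ tru`. -/
instance : LinearOrder Truth := LinearOrder.lift' rank rank_injective

instance : Fintype Truth where
  elems := ⟨[fls, unk, tru], by simp⟩
  complete := by intro a; cases a <;> simp

instance : Nonempty Truth := ⟨unk⟩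

/-- The truth order is a (finite, hence complete) lattice. -/
noncomputable instance : CompleteLinearOrder Truth :=
  Fintype.toCompleteLinearOrderOfNonempty Truth

/-- Negation of logical values. -/
def neg : Truth → Truth
  | fls => tru
  | unk => unk
  | tru => fls

end Truth

/-- A fact space: a set containing the three logical values, with an involution `compl`
that extends the negation of logical values and whose only fixed point is `unk`. -/
class FactSpace (F : Type u) where
  logical : Truth → F
  logical_injective : Function.Injective logical
  compl : F → F
  compl_compl : ∀ x, compl (compl x) = x
  compl_logical : ∀ v, compl (logical v) = logical v.neg
  compl_ne : ∀ x, x ≠ logical Truth.unk → compl x ≠ x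

/-- A justification frame: a set of defined facts and a set of rules `(x, A)` with head `x` and
body `A`. -/
structure JustificationFrame (F : Type u) [FactSpace F] where
  defined : Set F
  compl_mem : ∀ x ∈ defined, FactSpace.compl x ∈ defined
  logical_notMem : ∀ v, FactSpace.logical v ∉ defined
  rules : Set (F × Set F)
  head_mem : ∀ x A, (x, A) ∈ rules → x ∈ defined
  body_nonempty : ∀ x A, (x, A) ∈ rules → A.Nonempty
  exists_rule : ∀ x ∈ defined, ∃ A, (x, A) ∈ rules

/-- A three-valued interpretation of a fact space. -/
structure Interpretation (F : Type u) [FactSpace F] where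
  val : F → Truth
  val_compl : ∀ x, val (FactSpace.compl x) = (val x).neg
  val_logical : ∀ v, val (FactSpace.logical v) = v

/-- A directed graph with nodes labelled by facts. -/
structure LabelledGraph (F : Type u) where
  Node : Type u
  edge : Node → Node → Prop
  label : Node → F

namespace LabelledGraph

variable {F : Type u}

/-- An internal node has an outgoing edge. -/
def IsInternal (J : LabelledGraph F) (n : J.Node) : Prop := ∃ m, J.edge n m

/-- A leaf has no outgoing edge. -/
def IsLeaf (J : LabelledGraph F) (n : J.Node) : Prop := ¬ J.IsInternal n

/-- The underlying undirected graph has no cycles, where a self-loop counts as a cycle of length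
one and a pair of opposite edges counts as a cycle of length two. -/
def IsForest (J : LabelledGraph F) : Prop :=
  (SimpleGraph.fromRel J.edge).IsAcyclic ∧ ∀ n m, J.edge n m → ¬ J.edge m n

end LabelledGraph

namespace JustificationFrame

variable {F : Type u} [FactSpace F]

/-! ### Complementation -/

/-- The cases of `x`: the bodies of the rules with head `x`. -/
def cases (JF : JustificationFrame F) (x : F) : Set (Set F) := {A | (x, A) ∈ JF.rules}

/-- A selection function for `x` chooses an element from each case of `x` (only its values on the
cases of `x` are relevant). -/
def IsSelection (JF : JustificationFrame F) (x : F) (s : Set F → F) : Prop :=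
  ∀ A ∈ JF.cases x, s A ∈ A

/-- The rules `∼x ← ∼Im(s)` for `x` defined and `s` a selection function for `x`. -/
def complRules (JF : JustificationFrame F) : Set (F × Set F) :=
  {r | ∃ x ∈ JF.defined, ∃ s : Set F → F, JF.IsSelection x s ∧
    r = (FactSpace.compl x, FactSpace.compl '' (s '' JF.cases x))}

/-- The frame is fixed under complementation, i.e. under adding the rules in `complRules`. -/
def IsComplementary (JF : JustificationFrame F) : Prop :=
  JF.rules ∪ JF.complRules = JF.rules

/-- The rules for `x` and for `∼x` do not contradict each other: every body of a rule for `x`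
contains the complement of some element of every body of a rule for `∼x`. -/
def HasOpposedRules (JF : JustificationFrame F) : Prop :=
  ∀ x A B, (x, A) ∈ JF.rules → (FactSpace.compl x, B) ∈ JF.rules →
    (A ∩ FactSpace.compl '' B).Nonempty

/-! ### Branches and branch evaluations -/

/-- Defined facts. -/
abbrev Defined (JF : JustificationFrame F) : Type u := {x : F // x ∈ JF.defined}

/-- Open facts. -/
abbrev Open (JF : JustificationFrame F) : Type u := {x : F // x ∉ JF.defined}

/-- A branch is a finite non-empty sequence of defined facts followed by an open fact, or an
infinite sequence of defined facts. -/
inductive Branch (JF : JustificationFrame F) : Type u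
  | finite (l : List JF.Defined) (hl : l ≠ []) (o : JF.Open) : Branch JF
  | infinite (s : ℕ → JF.Defined) : Branch JF

/-- Complement of a defined fact. -/
def Defined.compl {JF : JustificationFrame F} (x : JF.Defined) : JF.Defined :=
  ⟨FactSpace.compl x.1, JF.compl_mem x.1 x.2⟩

/-- Complement of an open fact. -/
def Open.compl {JF : JustificationFrame F} (x : JF.Open) : JF.Open :=
  ⟨FactSpace.compl x.1, fun h => x.2 (by
    have := JF.compl_mem _ h
    rwa [FactSpace.compl_compl] at this)⟩

namespace Branch

variable {JF : JustificationFrame F}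

/-- The first element of a branch. -/
def start : JF.Branch → JF.Defined
  | finite l hl _ => l.head hl
  | infinite s => s 0

/-- The branch `∼b`, obtained by complementing every element of `b`. -/
def compl : JF.Branch → JF.Branch
  | finite l hl o => finite (l.map Defined.compl) (by simpa using hl) (Open.compl o)
  | infinite s => infinite fun i => Defined.compl (s i)

/-- The branch `p → b`: the finite sequence `p` followed by the branch `b`. -/
def prepend (p : List JF.Defined) : JF.Branch → JF.Branch
  | finite l hl o => finite (p ++ l) (by simp [hl]) o
  | infinite s => infinite fun i => if h : i < p.length then p[i] else s (i - p.length)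

end Branch

/-- A branch evaluation on the branches of `JF`. A justification frame together with a branch
evaluation is a justification system. -/
abbrev BranchEvaluation (JF : JustificationFrame F) : Type u := JF.Branch → F

/-- `y` occurs in the body of a rule for `x`. -/
def Step (JF : JustificationFrame F) (x y : JF.Defined) : Prop :=
  ∃ A, (x.1, A) ∈ JF.rules ∧ y.1 ∈ A

/-- `p → x` is a path; `p` may be empty. -/
def IsPathTo (JF : JustificationFrame F) (p : List JF.Defined) (x : JF.Defined) : Prop :=
  List.IsChain JF.Step (p ++ [x])

/-- `p` is a finite loop starting in `x`: `p` is non-empty, starts in `x`, and `p → x` is a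
path. -/
def IsLoop (JF : JustificationFrame F) (x : JF.Defined) (p : List JF.Defined) : Prop :=
  p.head? = some x ∧ JF.IsPathTo p x

/-- `M^*`: the finite concatenations of members of `M`. -/
def star {JF : JustificationFrame F} (M : Set (List JF.Defined)) : Set (List JF.Defined) :=
  {p | ∃ L : List (List JF.Defined), (∀ q ∈ L, q ∈ M) ∧ p = L.flatten}

/-- `M^ω`: the infinite concatenations `q 0, q 1, q 2, …` of members of `M`; for each `n`, the
sequence `s` begins with `q 0, …, q (n - 1)`. -/
def omega {JF : JustificationFrame F} (M : Set (List JF.Defined)) : Set JF.Branch :=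
  {b | ∃ (q : ℕ → List JF.Defined) (s : ℕ → JF.Defined), (∀ n, q n ∈ M) ∧
    (∀ n, (List.range ((List.range n).flatMap q).length).map s = (List.range n).flatMap q) ∧
    b = Branch.infinite s}

namespace BranchEvaluation

variable {JF : JustificationFrame F}

/-- Consistency: `B (∼b) = ∼(B b)` for all branches `b`. -/
def IsConsistent (B : JF.BranchEvaluation) : Prop :=
  ∀ b, B b.compl = FactSpace.compl (B b)

/-- Monotonicity with respect to an interpretation. -/
def IsMonotone (B : JF.BranchEvaluation) (I : Interpretation F) : Prop :=
  ∀ (b₁ b₂ : JF.Branch) (x : JF.Defined) (p : List JF.Defined),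
    b₁.start = x → b₂.start = x → JF.IsPathTo p x →
    I.val (B b₁) ≤ I.val (B b₂) → I.val (B (b₁.prepend p)) ≤ I.val (B (b₂.prepend p))

/-- Selectivity with respect to an interpretation. -/
def IsSelective (B : JF.BranchEvaluation) (I : Interpretation F) : Prop :=
  ∀ (p : List JF.Defined) (x : JF.Defined), JF.IsPathTo p x →
    ∀ (M N : Set (List JF.Defined)) (K : Set JF.Branch),
      (∀ q ∈ M, JF.IsLoop x q) → (∀ q ∈ N, JF.IsLoop x q) → (∀ b ∈ K, b.start = x) →
      ∀ b ∈ Set.image2 Branch.prepend (star (M ∪ N)) K ∪ omega (M ∪ N),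
        ∃ c ∈ omega M ∪ omega N ∪ K, ∃ d ∈ omega M ∪ omega N ∪ K,
          I.val (B (c.prepend p)) ≤ I.val (B (b.prepend p)) ∧
          I.val (B (b.prepend p)) ≤ I.val (B (d.prepend p))

end BranchEvaluation

/-! ### Justifications and supported values -/

/-- The labels of the children of an internal node form a case of its label. -/
def IsJustification (JF : JustificationFrame F) (J : LabelledGraph F) : Prop :=
  ∀ n, J.IsInternal n → (J.label n, {y | ∃ m, J.edge n m ∧ y = J.label m}) ∈ JF.rules

/-- Graph-like justifications: no two nodes have the same label. -/
def IsGraphLike (JF : JustificationFrame F) (J : LabelledGraph F) : Prop :=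
  JF.IsJustification J ∧ Function.Injective J.label

/-- Tree-like justifications: the underlying undirected graph is a forest. -/
def IsTreeLike (JF : JustificationFrame F) (J : LabelledGraph F) : Prop :=
  JF.IsJustification J ∧ J.IsForest

/-- No leaf is labelled with a defined fact. -/
def IsLocallyComplete (JF : JustificationFrame F) (J : LabelledGraph F) : Prop :=
  ∀ n, J.IsLeaf n → J.label n ∉ JF.defined

/-- `b` is the sequence of labels of a path in `J` that starts in a node labelled `x` and is
infinite or ends in a leaf. In a locally complete justification every such path, for `x` defined,
gives a branch. -/
def IsBranchOf (JF : JustificationFrame F) (J : LabelledGraph F) (x : F) : JF.Branch → Prop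
  | .finite l hl o => (l.head hl).1 = x ∧ ∃ (ns : List J.Node) (m : J.Node),
      List.IsChain J.edge (ns ++ [m]) ∧ J.IsLeaf m ∧
      ns.map J.label = l.map Subtype.val ∧ J.label m = o.1
  | .infinite s => (s 0).1 = x ∧ ∃ ns : ℕ → J.Node,
      (∀ i, J.edge (ns i) (ns (i + 1))) ∧ ∀ i, J.label (ns i) = (s i).1

/-- The value of `x` by the justification `J`: the greatest lower bound of the values of its
branches starting in `x`. -/
noncomputable def justValue (JF : JustificationFrame F) (B : JF.BranchEvaluation)
    (J : LabelledGraph F) (x : F) (I : Interpretation F) : Truth :=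
  sInf {v | ∃ b, JF.IsBranchOf J x b ∧ v = I.val (B b)}

open Classical in
/-- The graph-like supported value: for defined `x`, the least upper bound of the values of `x` by
the locally complete graph-like justifications with a node labelled `x`. -/
noncomputable def graphSupportedValue (JF : JustificationFrame F) (B : JF.BranchEvaluation)
    (x : F) (I : Interpretation F) : Truth :=
  if x ∈ JF.defined then
    sSup {v | ∃ J : LabelledGraph F, JF.IsGraphLike J ∧ JF.IsLocallyComplete J ∧
      (∃ n, J.label n = x) ∧ v = JF.justValue B J x I}
  else I.val x

open Classical in
/-- The tree-like supported value. -/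
noncomputable def treeSupportedValue (JF : JustificationFrame F) (B : JF.BranchEvaluation)
    (x : F) (I : Interpretation F) : Truth :=
  if x ∈ JF.defined then
    sSup {v | ∃ J : LabelledGraph F, JF.IsTreeLike J ∧ JF.IsLocallyComplete J ∧
      (∃ n, J.label n = x) ∧ v = JF.justValue B J x I}
  else I.val x

end JustificationFrame

/-! The supported value is the value of a game. At a defined fact one player chooses a rule for it,
at a rule the opponent chooses a fact in its body, and an open fact is repeated forever; the payoff
is the value of the branch traced out. There are finitely many positions because there are finitely
many facts.

Monotonicity and selectivity of `B` make this game positionally determined (`exists_positional`, in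
the manner of Gimbert and Zielonka): there is one value function `v`, and each player has a
memoryless strategy securing it. The proof is by induction on the number of moves. Splitting the
moves at a position of one player gives two smaller games. The better one supplies a positional
strategy for that player; the other player answers by remembering which of the two games the last
move from the split position belonged to. Selectivity shows that alternating between the games does
not help the owner of that position, and monotonicity transfers this to plays that reach it later.
Doing this for both players and comparing the values removes the memory.

A positional choice of rules is a graph-like justification, so `v x ≤ SV_g x`. A positional choice
of facts in bodies is a family of selection functions; in a frame fixed under complementation these
yield rules for the complements, hence a graph-like justification showing `∼v x ≤ SV_g (∼x)`.
Unravelling a graph into its paths gives `SV_g ≤ SV_t`. Finally, opposed rules force justifications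
of `x` and `∼x` to have complementary branches, so consistency gives `SV_t x ≤ ∼SV_t (∼x)`.
Altogether `∼SV_g (∼x) ≤ v x ≤ SV_g x ≤ SV_t x ≤ ∼SV_t (∼x) ≤ ∼SV_g (∼x)`, and all terms are equal.
-/

/-! ### Positional determinacy of finite games with monotone and selective payoffs -/

namespace PositionalGame

variable {S : Type*} {L : Type*}

/-- `w` is an infinite path of the graph `E`. -/
def IsPlay (E : S → S → Prop) (w : ℕ → S) : Prop := ∀ i, E (w i) (w (i + 1))

/-- Every position has a successor. -/
def NoDeadEnd (E : S → S → Prop) : Prop := ∀ s, ∃ s', E s s'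

/-- The sequence `s, w 0, w 1, …`. -/
def consSeq (s : S) (w : ℕ → S) : ℕ → S
  | 0 => s
  | i + 1 => w i

/-- The player owning the positions `own` has a positional strategy on `E` that secures a payoff
of at least `v s` from every position `s`. -/
def Positional [LE L] (own : S → Prop) (E : S → S → Prop) (val : (ℕ → S) → L) (v : S → L) : Prop :=
  ∃ σ : S → S, (∀ s, E s (σ s)) ∧ ∀ w, IsPlay E w →
    (∀ i, own (w i) → w (i + 1) = σ (w i)) → v (w 0) ≤ val w

/-- The player owning the positions `own` has a strategy on `E` with one bit of memory that secures
a payoff of at least `v s` from every position `s`. -/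
def OneBit [LE L] (own : S → Prop) (E : S → S → Prop) (val : (ℕ → S) → L) (v : S → L) : Prop :=
  ∃ (upd : Bool → S → S → Bool) (σ : Bool → S → S), (∀ q s, E s (σ q s)) ∧
    ∀ (w : ℕ → S) (m : ℕ → Bool), m 0 = true → IsPlay E w →
      (∀ i, m (i + 1) = upd (m i) (w i) (w (i + 1))) →
      (∀ i, own (w i) → w (i + 1) = σ (m i) (w i)) → v (w 0) ≤ val w

/-- Prepending a common predecessor to two plays preserves the order of the payoffs. -/
def MonotonePayoff [LE L] (E : S → S → Prop) (val : (ℕ → S) → L) : Prop :=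
  ∀ (s : S) (w₁ w₂ : ℕ → S), IsPlay E w₁ → IsPlay E w₂ → w₁ 0 = w₂ 0 → E s (w₁ 0) →
    val w₁ ≤ val w₂ → val (consSeq s w₁) ≤ val (consSeq s w₂)

/-- Switching between two subgraphs at visits of the initial position only is no better than
staying in one of them. -/
def SelectivePayoff [LE L] (E : S → S → Prop) (val : (ℕ → S) → L) : Prop :=
  ∀ H : Bool → S → S → Prop, (∀ b s s', H b s s' → E s s') →
    ∀ (w : ℕ → S) (c : ℕ → Bool), (∀ i, H (c i) (w i) (w (i + 1))) →
      (∀ i, w (i + 1) ≠ w 0 → c (i + 1) = c i) →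
      ∃ (d : ℕ → S) (b : Bool), d 0 = w 0 ∧ IsPlay (H b) d ∧ val w ≤ val d

theorem IsPlay.mono {E E' : S → S → Prop} {w : ℕ → S} (h : IsPlay E w)
    (hE : ∀ s s', E s s' → E' s s') : IsPlay E' w := fun i => hE _ _ (h i)

theorem IsPlay.shift {E : S → S → Prop} {w : ℕ → S} (h : IsPlay E w) (n : ℕ) :
    IsPlay E fun i => w (i + n) := fun i => by
  have := h (i + n)
  rwa [show i + n + 1 = i + 1 + n by omega] at this

theorem IsPlay.consSeq {E : S → S → Prop} {w : ℕ → S} (h : IsPlay E w) {s : S} (hs : E s (w 0)) :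
    IsPlay E (consSeq s w) := fun i => by
  cases i with
  | zero => exact hs
  | succ i => exact h i

theorem MonotonePayoff.dual [LE L] {E : S → S → Prop} {val : (ℕ → S) → L}
    (h : MonotonePayoff E val) : MonotonePayoff E (OrderDual.toDual ∘ val) :=
  fun s w₁ w₂ h₁ h₂ h₀ hs hle => h s w₂ w₁ h₂ h₁ h₀.symm (h₀ ▸ hs) hle

/-- Replacing the tail of a play, whose first part stays in a subgraph `H`. -/
theorem MonotonePayoff.exists_splice [Preorder L] {E H : S → S → Prop} {val : (ℕ → S) → L}
    (h : MonotonePayoff E val) (hH : ∀ s s', H s s' → E s s') (n : ℕ) :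
    ∀ {w d : ℕ → S}, IsPlay E w → IsPlay H d → d 0 = w n →
      (∀ i < n, H (w i) (w (i + 1))) → val (fun i => w (i + n)) ≤ val d →
      ∃ d', d' 0 = w 0 ∧ IsPlay H d' ∧ val w ≤ val d' := by
  induction n with
  | zero => exact fun {w d} _ hd h0 _ hle => ⟨d, h0, hd, hle⟩
  | succ n ih =>
    intro w d hw hd h0 hlt hle
    obtain ⟨d', h0', hd', hle'⟩ := ih (w := fun i => w (i + 1)) (hw.shift 1) hd h0
      (fun i hi => hlt (i + 1) (by omega)) (by
        simpa only [show ∀ i, i + n + 1 = i + (n + 1) from fun i => by omega] using hle)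
    have hw0 : consSeq (w 0) (fun i => w (i + 1)) = w := by
      funext i; cases i <;> rfl
    refine ⟨consSeq (w 0) d', rfl, hd'.consSeq (h0' ▸ hlt 0 (by omega)), ?_⟩
    have := h (w 0) _ _ (hw.shift 1) (hd'.mono hH) h0'.symm (hw 0) hle'
    rwa [hw0] at this

/-! ### Combining strategies and splitting a position -/

theorem exists_seq_of_step {X : Type*} {f : X → X} (x : X) :
    ∃ u : ℕ → X, u 0 = x ∧ ∀ i, u (i + 1) = f (u i) :=
  ⟨fun n => f^[n] x, rfl, fun i => Function.iterate_succ_apply' f i x⟩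

/-- Playing the two strategies against each other from `s` produces a single play whose payoff is
bounded by `v s` from below and by `v' s` from above. -/
theorem OneBit.le_of_dual [Preorder L] {own opp : S → Prop} (hopp : ∀ s, own s ↔ ¬ opp s)
    {E : S → S → Prop} {val : (ℕ → S) → L} {v v' : S → L} (h : OneBit own E val v)
    (h' : OneBit opp E (OrderDual.toDual ∘ val) (OrderDual.toDual ∘ v')) (s : S) :
    v s ≤ v' s := by
  classical
  obtain ⟨upd, σ, hσ, hval⟩ := h
  obtain ⟨upd', τ, hτ, hval'⟩ := h'
  let next : S × Bool × Bool → S := fun x => if own x.1 then σ x.2.1 x.1 else τ x.2.2 x.1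
  obtain ⟨u, hu0, hu⟩ := exists_seq_of_step
    (f := fun x => (next x, upd x.2.1 x.1 (next x), upd' x.2.2 x.1 (next x))) (s, true, true)
  have hnext : ∀ i, (u (i + 1)).1 = next (u i) := fun i => by rw [hu]
  have hplay : IsPlay E fun i => (u i).1 := fun i => by
    dsimp only
    rw [hnext]
    by_cases ho : own (u i).1
    · simpa [next, ho] using hσ _ _
    · simpa [next, ho] using hτ _ _
  have h1 := hval (fun i => (u i).1) (fun i => (u i).2.1) (by simp [hu0]) hplay
    (fun i => by simp only [hu]) (fun i ho => by rw [hnext]; simp [next, ho])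
  have h2 := hval' (fun i => (u i).1) (fun i => (u i).2.2) (by simp [hu0]) hplay
    (fun i => by simp only [hu]) (fun i ho => by
      rw [hnext]; simp [next, (hopp _).not_left.2 ho])
  simp only [hu0] at h1 h2
  exact le_trans h1 h2

theorem Positional.oneBit [LE L] {own : S → Prop} {E : S → S → Prop} {val : (ℕ → S) → L}
    {v : S → L} (h : Positional own E val v) : OneBit own E val v := by
  obtain ⟨σ, hσ, hval⟩ := h
  exact ⟨fun _ _ _ => true, fun _ => σ, fun _ => hσ, fun w _ _ hw _ hc => hval w hw hc⟩

/-- A player without choices needs no memory. -/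
theorem OneBit.positional [LE L] {own : S → Prop} {E : S → S → Prop} {val : (ℕ → S) → L}
    {v : S → L} (h : OneBit own E val v) (huniq : ∀ s a b, own s → E s a → E s b → a = b) :
    Positional own E val v := by
  obtain ⟨upd, σ, hσ, hval⟩ := h
  refine ⟨σ true, hσ true, fun w hw _ => ?_⟩
  refine hval w (fun n => Nat.rec true (fun i m => upd m (w i) (w (i + 1))) n) rfl hw
    (fun i => rfl) fun i ho => huniq _ _ _ ho (hw i) (hσ _ _)

/-- The owner of `t` gains nothing from the worse half `E₂`, so an optimal strategy for `E₁` remains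
good on `E`. The opponent follows `τ₁` or `τ₂` according to the half used by the last move from `t`,
starting with `τ₁`. -/
theorem Positional.of_split [LinearOrder L] {own opp : S → Prop} (hopp : ∀ s, own s ↔ ¬ opp s)
    {E₀ : S → S → Prop} {val : (ℕ → S) → L} (hmono : MonotonePayoff E₀ val)
    (hsel : SelectivePayoff E₀ val) {E E₁ E₂ : S → S → Prop} (hE : ∀ s s', E s s' → E₀ s s')
    {t : S} (ht : own t) (h₁ : ∀ s s', E₁ s s' → E s s') (h₂ : ∀ s s', E₂ s s' → E s s')
    (hoff₁ : ∀ s s', s ≠ t → E s s' → E₁ s s') (hoff₂ : ∀ s s', s ≠ t → E s s' → E₂ s s')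
    (hsplit : ∀ s', E t s' → E₁ t s' ∨ E₂ t s') {v₁ v₂ : S → L}
    (hown : Positional own E₁ val v₁)
    (hopp₁ : Positional opp E₁ (OrderDual.toDual ∘ val) (OrderDual.toDual ∘ v₁))
    (hopp₂ : Positional opp E₂ (OrderDual.toDual ∘ val) (OrderDual.toDual ∘ v₂))
    (hle : v₂ t ≤ v₁ t) :
    Positional own E val v₁ ∧ OneBit opp E (OrderDual.toDual ∘ val) (OrderDual.toDual ∘ v₁) := by
  classical
  obtain ⟨σ, hσ, hσv⟩ := hown
  obtain ⟨τ₁, hτ₁, hτv₁⟩ := hopp₁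
  obtain ⟨τ₂, hτ₂, hτv₂⟩ := hopp₂
  refine ⟨⟨σ, fun s => h₁ _ _ (hσ s), fun w hw hc => hσv w (fun i => ?_) hc⟩, ?_⟩
  · by_cases hi : w i = t
    · rw [hc i (hi ▸ ht)]; exact hσ _
    · exact hoff₁ _ _ hi (hw i)
  -- `H b` is the half selected by `b` with the opponent's moves fixed, so its plays are exactly
  -- those bounded by `v₁` or `v₂`.
  let H : Bool → S → S → Prop := fun b s s' =>
    if b then E₁ s s' ∧ (opp s → s' = τ₁ s) else E₂ s s' ∧ (opp s → s' = τ₂ s)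
  have hH₀ : ∀ b s s', H b s s' → E₀ s s' := by
    intro b s s' h
    cases b
    · exact hE _ _ (h₂ _ _ (by simpa [H] using h.1))
    · exact hE _ _ (h₁ _ _ (by simpa [H] using h.1))
  have hHtrue : ∀ d, IsPlay (H true) d → val d ≤ v₁ (d 0) := fun d hd =>
    hτv₁ d (fun i => (show _ ∧ _ by simpa [H] using hd i).1)
      (fun i => (show _ ∧ _ by simpa [H] using hd i).2)
  have hHfalse : ∀ d, IsPlay (H false) d → val d ≤ v₂ (d 0) := fun d hd =>
    hτv₂ d (fun i => (show _ ∧ _ by simpa [H] using hd i).1)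
      (fun i => (show _ ∧ _ by simpa [H] using hd i).2)
  have htopp : ¬ opp t := (hopp t).1 ht
  refine ⟨fun q s s' => if s = t then decide (E₁ t s') else q,
    fun q => if q then τ₁ else τ₂, ?_, fun w m hm0 hw hm hc => ?_⟩
  · intro q s
    cases q
    · simpa using h₂ _ _ (hτ₂ s)
    · simpa using h₁ _ _ (hτ₁ s)
  dsimp only at hm hc
  -- The bit that governs the move from `w i` is the updated one, since a move from `t` itself
  -- decides the half.
  have hstep : ∀ i, H (m (i + 1)) (w i) (w (i + 1)) := by
    intro i
    by_cases hi : w i = t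
    · have := hw i
      rw [hi] at this
      by_cases h1 : E₁ t (w (i + 1))
      · simp [hm, hi, H, h1, htopp]
      · simp [hm, hi, H, h1, htopp, (hsplit _ this).resolve_left h1]
    · rw [hm, if_neg hi]
      cases hq : m i
      · have := hc i
        simp only [hq] at this
        exact (by simpa [H] using ⟨hoff₂ _ _ hi (hw i), this⟩)
      · have := hc i
        simp only [hq] at this
        exact (by simpa [H] using ⟨hoff₁ _ _ hi (hw i), this⟩)
  have hconst : ∀ n, (∀ i < n, w i ≠ t) → ∀ i ≤ n, m i = true := by
    intro n hn i
    induction i with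
    | zero => exact fun _ => hm0
    | succ i ih =>
      intro hi
      rw [hm, if_neg (hn i (by omega)), ih (by omega)]
  show val w ≤ v₁ (w 0)
  by_cases hvis : ∃ n, w n = t
  · have hn := Nat.find_spec hvis
    have hmin : ∀ i < Nat.find hvis, w i ≠ t := fun i hi => Nat.find_min hvis hi
    generalize Nat.find hvis = n at hn hmin
    -- From the first visit of `t` on, the half changes only at visits of `t`, so selectivity bounds
    -- the tail by a play within one half.
    obtain ⟨d, b, hd0, hd, hdle⟩ := hsel H hH₀ (fun i => w (i + n)) (fun i => m (i + n + 1))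
      (fun i => by
        have := hstep (i + n)
        simpa only [show i + 1 + n = i + n + 1 by omega] using this)
      (fun i hi => by
        simp only [zero_add, hn] at hi
        rw [hm (i + 1 + n), if_neg hi, show i + 1 + n = i + n + 1 by omega])
    simp only [zero_add, hn] at hd0
    have hdv : val d ≤ v₁ t := by
      cases b
      · exact hd0 ▸ (hHfalse d hd).trans (by rwa [hd0])
      · exact hd0 ▸ hHtrue d hd
    -- Monotonicity compares plays, not bounds. The play of `σ` against `τ₁` from `t` attains at
    -- least `v₁ t` inside `H true`; substituted for the tail of `w` it gives a play to which the
    -- bound for `τ₁` applies.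
    obtain ⟨e, he0, he⟩ := exists_seq_of_step (f := fun s => if own s then σ s else τ₁ s) t
    have heH : IsPlay (H true) e := fun i => by
      rw [he]
      by_cases ho : own (e i)
      · simp [H, ho, hσ, (hopp _).1 ho]
      · simp [H, ho, hτ₁]
    have hev : v₁ t ≤ val e := by
      rw [← he0]
      refine hσv e (fun i => ?_) (fun i ho => by rw [he, if_pos ho])
      exact (show _ ∧ _ by simpa [H] using heH i).1
    obtain ⟨d', hd'0, hd', hled'⟩ := hmono.exists_splice (hH₀ true) n (hw.mono hE) heH
      (he0.trans hn.symm) (fun i hi => by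
        have := hstep i
        rwa [hconst n hmin (i + 1) hi] at this) (hdle.trans (hdv.trans hev))
    exact hled'.trans (hd'0 ▸ hHtrue d' hd')
  · push Not at hvis
    refine hHtrue w fun i => ?_
    have := hstep i
    rwa [hconst (i + 1) (fun j _ => hvis j) (i + 1) le_rfl] at this

/-- The two halves forbid and force the move from `t` to `b`. Each loses a move, so the induction
hypothesis applies to both, and the half with the larger value at `t` determines the value of the
game. -/
theorem exists_positional_oneBit [Finite S] [LinearOrder L] {own opp : S → Prop}
    (hopp : ∀ s, own s ↔ ¬ opp s) {E₀ : S → S → Prop} {val : (ℕ → S) → L}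
    (hmono : MonotonePayoff E₀ val) (hsel : SelectivePayoff E₀ val) {E : S → S → Prop}
    (hE : ∀ s s', E s s' → E₀ s s') (htot : NoDeadEnd E)
    (ih : ∀ E' : S → S → Prop, (∀ s s', E' s s' → E s s') → NoDeadEnd E' →
      {x : S × S | E' x.1 x.2}.ncard < {x : S × S | E x.1 x.2}.ncard →
      ∃ v : S → L, Positional own E' val v ∧
        Positional opp E' (OrderDual.toDual ∘ val) (OrderDual.toDual ∘ v))
    {t a b : S} (ht : own t) (ha : E t a) (hb : E t b) (hab : a ≠ b) :
    ∃ v : S → L, Positional own E val v ∧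
      OneBit opp E (OrderDual.toDual ∘ val) (OrderDual.toDual ∘ v) := by
  let E₁ : S → S → Prop := fun s s' => E s s' ∧ (s = t → s' ≠ b)
  let E₂ : S → S → Prop := fun s s' => E s s' ∧ (s = t → s' = b)
  have hlt : ∀ E' : S → S → Prop, (∀ s s', E' s s' → E s s') → (∃ s', E t s' ∧ ¬ E' t s') →
      {x : S × S | E' x.1 x.2}.ncard < {x : S × S | E x.1 x.2}.ncard := by
    rintro E' hE' ⟨s', h1, h2⟩
    refine Set.ncard_lt_ncard ⟨fun x hx => hE' _ _ hx, fun h => h2 ?_⟩ (Set.toFinite _)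
    exact h (show (t, s') ∈ {x : S × S | E x.1 x.2} from h1)
  have h₁ : ∀ s s', E₁ s s' → E s s' := fun _ _ h => h.1
  have h₂ : ∀ s s', E₂ s s' → E s s' := fun _ _ h => h.1
  have hoff₁ : ∀ s s', s ≠ t → E s s' → E₁ s s' := fun s s' hs h => ⟨h, fun h' => absurd h' hs⟩
  have hoff₂ : ∀ s s', s ≠ t → E s s' → E₂ s s' := fun s s' hs h => ⟨h, fun h' => absurd h' hs⟩
  have htot₁ : NoDeadEnd E₁ := fun s => by
    by_cases hs : s = t
    · exact ⟨a, hs ▸ ha, fun _ => hab⟩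
    · exact (htot s).imp fun s' h => hoff₁ s s' hs h
  have htot₂ : NoDeadEnd E₂ := fun s => by
    by_cases hs : s = t
    · exact ⟨b, hs ▸ hb, fun _ => rfl⟩
    · exact (htot s).imp fun s' h => hoff₂ s s' hs h
  obtain ⟨v₁, hv₁, hv₁'⟩ := ih E₁ h₁ htot₁ (hlt _ h₁ ⟨b, hb, fun h => h.2 rfl rfl⟩)
  obtain ⟨v₂, hv₂, hv₂'⟩ := ih E₂ h₂ htot₂ (hlt _ h₂ ⟨a, ha, fun h => hab (h.2 rfl)⟩)
  have hsplit : ∀ s', E t s' → E₁ t s' ∨ E₂ t s' := fun s' h => by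
    by_cases hs : s' = b
    · exact Or.inr ⟨h, fun _ => hs⟩
    · exact Or.inl ⟨h, fun _ => hs⟩
  rcases le_total (v₂ t) (v₁ t) with hle | hle
  · exact ⟨v₁, Positional.of_split hopp hmono hsel hE ht h₁ h₂ hoff₁ hoff₂ hsplit hv₁ hv₁' hv₂' hle⟩
  · exact ⟨v₂, Positional.of_split hopp hmono hsel hE ht h₂ h₁ hoff₂ hoff₁
      (fun s' h => (hsplit s' h).symm) hv₂ hv₂' hv₁' hle⟩

/-- Positional determinacy: both players have optimal positional strategies. -/
theorem exists_positional [Finite S] [LinearOrder L] {own opp : S → Prop}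
    (hopp : ∀ s, own s ↔ ¬ opp s) {E₀ : S → S → Prop} {val : (ℕ → S) → L}
    (hmono : MonotonePayoff E₀ val) (hsel : SelectivePayoff E₀ val)
    (hsel' : SelectivePayoff E₀ (OrderDual.toDual ∘ val)) (E : S → S → Prop)
    (hE : ∀ s s', E s s' → E₀ s s') (htot : NoDeadEnd E) :
    ∃ v : S → L, Positional own E val v ∧
      Positional opp E (OrderDual.toDual ∘ val) (OrderDual.toDual ∘ v) := by
  have hopp' : ∀ s, opp s ↔ ¬ own s := fun s => by rw [hopp]; tauto
  induction hk : {x : S × S | E x.1 x.2}.ncard using Nat.strong_induction_on generalizing E with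
  | _ k ih =>
  have ih' : ∀ E' : S → S → Prop, (∀ s s', E' s s' → E s s') → NoDeadEnd E' →
      {x : S × S | E' x.1 x.2}.ncard < {x : S × S | E x.1 x.2}.ncard →
      ∃ v : S → L, Positional own E' val v ∧
        Positional opp E' (OrderDual.toDual ∘ val) (OrderDual.toDual ∘ v) :=
    fun E' hE' htot' hlt => ih _ (hk ▸ hlt) E' (fun s s' h => hE _ _ (hE' _ _ h)) htot' rfl
  have hA : (∃ t a b, own t ∧ E t a ∧ E t b ∧ a ≠ b) → ∃ v : S → L, Positional own E val v ∧
      OneBit opp E (OrderDual.toDual ∘ val) (OrderDual.toDual ∘ v) :=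
    fun ⟨t, a, b, ht, ha, hb, hab⟩ =>
      exists_positional_oneBit hopp hmono hsel hE htot ih' ht ha hb hab
  have hB : (∃ t a b, opp t ∧ E t a ∧ E t b ∧ a ≠ b) → ∃ v : S → L, OneBit own E val v ∧
      Positional opp E (OrderDual.toDual ∘ val) (OrderDual.toDual ∘ v) := by
    rintro ⟨t, a, b, ht, ha, hb, hab⟩
    obtain ⟨v, hv, hv'⟩ := exists_positional_oneBit hopp' hmono.dual hsel' hE htot
      (fun E' h1 h2 h3 => by
        obtain ⟨v, hv, hv'⟩ := ih' E' h1 h2 h3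
        exact ⟨OrderDual.toDual ∘ v, hv', hv⟩) ht ha hb hab
    exact ⟨OrderDual.ofDual ∘ v, hv', hv⟩
  have huniq : ∀ {P : S → Prop}, (¬ ∃ t a b, P t ∧ E t a ∧ E t b ∧ a ≠ b) →
      ∀ s a b, P s → E s a → E s b → a = b := fun h s a b hs ha hb =>
    by_contra fun hab => h ⟨s, a, b, hs, ha, hb, hab⟩
  -- If both players have a real choice, each split makes one of them positional, and the two values
  -- agree by `OneBit.le_of_dual`. A player without choices needs no memory; if neither has one,
  -- each position starts a single play.
  by_cases hcA : ∃ t a b, own t ∧ E t a ∧ E t b ∧ a ≠ b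
  · obtain ⟨v, hv, hv'⟩ := hA hcA
    by_cases hcB : ∃ t a b, opp t ∧ E t a ∧ E t b ∧ a ≠ b
    · obtain ⟨u, hu, hu'⟩ := hB hcB
      have : u = v := funext fun s => le_antisymm (hu.le_of_dual hopp hv' s)
        (hv.oneBit.le_of_dual hopp hu'.oneBit s)
      exact ⟨v, hv, this ▸ hu'⟩
    · exact ⟨v, hv, hv'.positional (huniq hcB)⟩
  · by_cases hcB : ∃ t a b, opp t ∧ E t a ∧ E t b ∧ a ≠ b
    · obtain ⟨u, hu, hu'⟩ := hB hcB
      exact ⟨u, hu.positional (huniq hcA), hu'⟩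
    · choose f hf using htot
      have hplay : ∀ w, IsPlay E w → w = fun n => f^[n] (w 0) := by
        intro w hw
        funext n
        induction n with
        | zero => rfl
        | succ n ihn =>
          rw [Function.iterate_succ_apply', ← ihn]
          by_cases ho : own (w n)
          · exact huniq hcA _ _ _ ho (hw n) (hf _)
          · exact huniq hcB _ _ _ ((hopp' _).2 ho) (hw n) (hf _)
      refine ⟨fun s => val fun n => f^[n] s, ⟨f, hf, fun w hw _ => ?_⟩, ⟨f, hf, fun w hw _ => ?_⟩⟩
      · exact le_of_eq (congrArg val (hplay w hw).symm)
      · exact le_of_eq (congrArg val (hplay w hw).symm)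

end PositionalGame

namespace PositionalGame

variable {S : Type*}

/-! ### Decomposing sequences into loops -/

/-- `l` is a loop at `t` in the graph `R`. -/
def IsLoopAt (R : S → S → Prop) (t : S) (l : List S) : Prop :=
  l.head? = some t ∧ List.IsChain R (l ++ [t])

theorem isLoopAt_segment {R : S → S → Prop} {t : S} {u : ℕ → S} {n m : ℕ} (hnm : n < m)
    (hn : u n = t) (hm : u m = t) (hR : ∀ i, n ≤ i → i < m → R (u i) (u (i + 1))) :
    IsLoopAt R t ((List.range' n (m - n)).map u) := by
  constructor
  · rw [List.head?_map, List.head?_range', if_neg (by omega)]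
    simp [hn]
  · have : (List.range' n (m - n)).map u ++ [t] = (List.range' n (m - n + 1)).map u := by
      rw [List.range'_concat, List.map_append]
      simp [show n + (m - n) = m by omega, hm]
    rw [this, List.isChain_iff_getElem]
    intro i hi
    simp only [List.length_map, List.length_range'] at hi
    simpa [add_assoc] using hR (n + i) (by omega) (by omega)

theorem mode_eq_of_no_visit {t : S} {u : ℕ → S} {c : ℕ → Bool}
    (hc : ∀ i, u (i + 1) ≠ t → c (i + 1) = c i) {n m : ℕ}
    (hno : ∀ i, n < i → i < m → u i ≠ t) {i : ℕ} (hni : n ≤ i) (him : i < m) : c i = c n := by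
  induction i, hni using Nat.le_induction with
  | base => rfl
  | succ i hi ih => rw [hc i (hno _ (by omega) him), ih (by omega)]

/-- Cutting at the visits of `u 0` gives segments on which `c` is constant, so each is a loop in a
single graph `R b`. -/
theorem exists_loops_of_visit {R : Bool → S → S → Prop} {u : ℕ → S} {c : ℕ → Bool}
    (hc : ∀ i, u (i + 1) ≠ u 0 → c (i + 1) = c i) (n : ℕ) (hn : u n = u 0)
    (hR : ∀ i < n, R (c i) (u i) (u (i + 1))) :
    ∃ Q : List (List S), (∀ l ∈ Q, ∃ b, IsLoopAt (R b) (u 0) l) ∧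
      (List.range n).map u = Q.flatten := by
  classical
  induction n using Nat.strong_induction_on with
  | _ n ih =>
  rcases Nat.eq_zero_or_pos n with rfl | hpos
  · exact ⟨[], by simp, by simp⟩
  let k := Nat.findGreatest (fun i => u i = u 0) (n - 1)
  have hk : u k = u 0 := Nat.findGreatest_spec (P := fun i => u i = u 0) (Nat.zero_le (n - 1)) rfl
  have hkn : k < n := by
    have : k ≤ n - 1 := Nat.findGreatest_le _
    omega
  have hno : ∀ i, k < i → i < n → u i ≠ u 0 := fun i h1 h2 =>
    Nat.findGreatest_is_greatest h1 (by omega)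
  obtain ⟨Q, hQ, hQeq⟩ := ih k hkn hk fun i hi => hR i (by omega)
  refine ⟨Q ++ [(List.range' k (n - k)).map u], ?_, ?_⟩
  · intro l hl
    rcases List.mem_append.1 hl with hl | hl
    · exact hQ l hl
    · rw [List.mem_singleton.1 hl]
      refine ⟨c k, isLoopAt_segment hkn hk hn fun i h1 h2 => ?_⟩
      rw [← mode_eq_of_no_visit hc hno h1 h2]
      exact hR i h2
  · rw [List.flatten_append, ← hQeq, List.flatten_singleton, ← List.map_append,
      List.range_eq_range', List.range_eq_range']
    congr 1
    have := List.range'_append (s := 0) (m := k) (n := n - k) (step := 1)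
    rw [show k + (n - k) = n by omega] at this
    simpa using this.symm

theorem exists_loops_of_frequent_visits {R : Bool → S → S → Prop} {u : ℕ → S} {c : ℕ → Bool}
    (hc : ∀ i, u (i + 1) ≠ u 0 → c (i + 1) = c i) (hvis : ∀ n, ∃ m, n < m ∧ u m = u 0)
    (hR : ∀ i, R (c i) (u i) (u (i + 1))) :
    ∃ Q : ℕ → List S, (∀ n, ∃ b, IsLoopAt (R b) (u 0) (Q n)) ∧
      ∀ n, ∃ k, (List.range n).flatMap Q = (List.range k).map u := by
  classical
  let next : ℕ → ℕ := fun n => Nat.find (hvis n)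
  have hnext : ∀ n, n < next n ∧ u (next n) = u 0 := fun n => Nat.find_spec (hvis n)
  have hmin : ∀ n i, n < i → i < next n → u i ≠ u 0 := fun n i h1 h2 h3 =>
    Nat.find_min (hvis n) h2 ⟨h1, h3⟩
  obtain ⟨a, ha0, ha⟩ := exists_seq_of_step (f := next) 0
  have hau : ∀ n, u (a n) = u 0 := fun n => by
    cases n with
    | zero => rw [ha0]
    | succ n => rw [ha]; exact (hnext _).2
  refine ⟨fun n => (List.range' (a n) (a (n + 1) - a n)).map u, fun n => ⟨c (a n), ?_⟩,
    fun n => ⟨a n, ?_⟩⟩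
  · dsimp only
    rw [ha]
    refine isLoopAt_segment (hnext _).1 (hau n) (hnext _).2 fun i h1 h2 => ?_
    rw [← mode_eq_of_no_visit hc (hmin _) h1 h2]
    exact hR i
  · induction n with
    | zero => simp [ha0]
    | succ n ih =>
      rw [List.range_succ, List.flatMap_append, ih, List.flatMap_singleton, ← List.map_append,
        List.range_eq_range', List.range_eq_range']
      congr 1
      have := List.range'_append (s := 0) (m := a n) (n := a (n + 1) - a n) (step := 1)
      rw [show a n + (a (n + 1) - a n) = a (n + 1) by have := (hnext (a n)).1; rw [ha]; omega]
        at this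
      simpa using this

/-- Each loop omits its return to `t`, which is the head of the next loop, so consecutive loops join
to a path. -/
theorem exists_play_of_loops {R : S → S → Prop} {t : S} {Q : ℕ → List S}
    (hQ : ∀ n, IsLoopAt R t (Q n)) :
    ∃ u : ℕ → S, u 0 = t ∧ IsPlay R u ∧
      ∀ n i (hi : i < ((List.range n).flatMap Q).length), ((List.range n).flatMap Q)[i] = u i := by
  let P : ℕ → List S := fun n => (List.range n).flatMap Q
  have hPsucc : ∀ n, P (n + 1) = P n ++ Q n := fun n => by
    simp [P, List.range_succ]
  have hne : ∀ n, Q n ≠ [] := fun n h => by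
    have := (hQ n).1
    simp [h] at this
  have hlen : ∀ n, n ≤ (P n).length := fun n => by
    induction n with
    | zero => omega
    | succ n ih =>
      rw [hPsucc, List.length_append]
      have := List.length_pos_iff.2 (hne n)
      omega
  have hpre : ∀ {n m}, n ≤ m → P n <+: P m := fun {n m} hnm => by
    induction m, hnm using Nat.le_induction with
    | base => exact List.prefix_rfl
    | succ m _ ih => rw [hPsucc]; exact ih.trans (List.prefix_append _ _)
  have hchain : ∀ n, List.IsChain R (P n ++ [t]) := fun n => by
    induction n with
    | zero => simp [P]
    | succ n ih =>
      obtain ⟨l, hl⟩ : ∃ l, Q n = t :: l := by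
        have := (hQ n).1
        cases h : Q n with
        | nil => exact absurd h (hne n)
        | cons a l => rw [h] at this; simp at this; exact ⟨l, by rw [this]⟩
      have h2 := (hQ n).2
      rw [hPsucc, hl]
      rw [hl] at h2
      simpa using List.IsChain.append_overlap (l₂ := [t]) ih (by simpa using h2) (by simp)
  -- Loops are non-empty, so the first `i + 1` of them already contain entry `i`.
  let u : ℕ → S := fun i => (P (i + 1))[i]'(hlen (i + 1))
  have hu : ∀ n i (hi : i < (P n).length), (P n)[i] = u i := fun n i hi => by
    rcases le_total n (i + 1) with h | h
    · exact (hpre h).getElem hi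
    · exact ((hpre h).getElem (hlen (i + 1))).symm
  refine ⟨u, ?_, fun i => ?_, hu⟩
  · obtain ⟨h, -⟩ := hQ 0
    have h1 : P 1 = Q 0 := by simp [P]
    rw [← h1] at h
    rw [List.head?_eq_getElem?, List.getElem?_eq_getElem (hlen 1), Option.some_inj] at h
    exact h
  · have h := hlen (i + 2)
    have := List.isChain_iff_getElem.1 (List.isChain_append.1 (hchain (i + 2))).1 i (by omega)
    rwa [hu, hu] at this

/-- The intermediate positions of the double steps fill the odd places. -/
theorem exists_play_of_comp {H : S → S → Prop} {u : ℕ → S} (hu : IsPlay (Relation.Comp H H) u) :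
    ∃ w, IsPlay H w ∧ ∀ i, w (2 * i) = u i := by
  choose v hv using hu
  refine ⟨fun j => if j % 2 = 0 then u (j / 2) else v (j / 2), fun j => ?_, fun i => by simp⟩
  rcases Nat.mod_two_eq_zero_or_one j with h | h
  · simpa [h, show (j + 1) % 2 = 1 by omega, show (j + 1) / 2 = j / 2 by omega]
      using (hv (j / 2)).1
  · simpa [h, show (j + 1) % 2 = 0 by omega, show (j + 1) / 2 = j / 2 + 1 by omega]
      using (hv (j / 2)).2

end PositionalGame

namespace JustificationFrame

variable {F : Type u} [FactSpace F] {JF : JustificationFrame F}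

open PositionalGame

/-! ### Branches as sequences of facts -/

namespace Branch

/-- The sequence of facts of a branch; the final open fact of a finite branch is repeated. -/
def toSeq : JF.Branch → ℕ → F
  | finite l _ o => fun i => (l.map Subtype.val).getD i o.1
  | infinite s => fun i => (s i).1

theorem toSeq_finite_of_lt {l : List JF.Defined} {hl : l ≠ []} {o : JF.Open} {i : ℕ}
    (hi : i < l.length) : (finite l hl o).toSeq i = l[i].1 := by
  simp [toSeq, hi]

theorem toSeq_finite_of_le {l : List JF.Defined} {hl : l ≠ []} {o : JF.Open} {i : ℕ}
    (hi : l.length ≤ i) : (finite l hl o).toSeq i = o.1 := by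
  simp [toSeq, hi]

theorem toSeq_zero (b : JF.Branch) : b.toSeq 0 = b.start.1 := by
  cases b with
  | infinite s => rfl
  | finite l hl o =>
    rw [toSeq_finite_of_lt (List.length_pos_iff.2 hl)]
    simp [start, List.head_eq_getElem]

/-- The first entry that is not defined marks the end of a finite branch, so the padding loses no
information. -/
theorem toSeq_injective : Function.Injective (toSeq (JF := JF)) := by
  have hlen : ∀ {l l' : List JF.Defined} {hl hl'} {o o' : JF.Open},
      (finite l hl o).toSeq = (finite l' hl' o').toSeq → l'.length ≤ l.length := by
    intro l l' hl hl' o o' h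
    by_contra hlt
    push Not at hlt
    have := congrFun h l.length
    rw [toSeq_finite_of_le le_rfl, toSeq_finite_of_lt hlt] at this
    exact o.2 (this ▸ Subtype.prop _)
  have hne : ∀ {l : List JF.Defined} {hl} {o : JF.Open} {s : ℕ → JF.Defined},
      (finite l hl o).toSeq ≠ (infinite s).toSeq := by
    intro l hl o s h
    have := congrFun h l.length
    rw [toSeq_finite_of_le le_rfl] at this
    exact o.2 (this ▸ (s l.length).2)
  intro b b' h
  cases b with
  | infinite s =>
    cases b' with
    | infinite s' => exact congrArg infinite (funext fun i => Subtype.ext (congrFun h i))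
    | finite l' hl' o' => exact absurd h.symm hne
  | finite l hl o =>
    cases b' with
    | infinite s' => exact absurd h hne
    | finite l' hl' o' =>
      have hll : l.length = l'.length := le_antisymm (hlen h.symm) (hlen h)
      have h1 : l = l' := List.ext_getElem hll fun i hi hi' => by
        have := congrFun h i
        rw [toSeq_finite_of_lt hi, toSeq_finite_of_lt hi'] at this
        exact Subtype.ext this
      subst h1
      have h2 := congrFun h l.length
      rw [toSeq_finite_of_le le_rfl, toSeq_finite_of_le le_rfl] at h2
      rw [Subtype.ext h2]

theorem toSeq_prepend (p : List JF.Defined) (b : JF.Branch) (i : ℕ) :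
    (b.prepend p).toSeq i = if h : i < p.length then p[i].1 else b.toSeq (i - p.length) := by
  cases b with
  | infinite s =>
    simp only [prepend, toSeq]
    split_ifs <;> rfl
  | finite l hl o =>
    simp only [prepend]
    split_ifs with h
    · rw [toSeq_finite_of_lt (by simp; omega)]
      simp [h]
    · rcases lt_or_ge (i - p.length) l.length with h' | h'
      · rw [toSeq_finite_of_lt (by simp; omega), toSeq_finite_of_lt h']
        simp [List.getElem_append_right (not_lt.1 h)]
      · rw [toSeq_finite_of_le (by simp; omega), toSeq_finite_of_le h']

theorem prepend_nil (b : JF.Branch) : b.prepend [] = b :=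
  toSeq_injective (funext fun i => by simp [toSeq_prepend])

theorem toSeq_compl (b : JF.Branch) (i : ℕ) : b.compl.toSeq i = FactSpace.compl (b.toSeq i) := by
  cases b with
  | infinite s => rfl
  | finite l hl o =>
    simp only [compl]
    rcases lt_or_ge i l.length with h | h
    · rw [toSeq_finite_of_lt (by simpa using h), toSeq_finite_of_lt h]
      simp [Defined.compl]
    · rw [toSeq_finite_of_le (by simpa using h), toSeq_finite_of_le h]
      rfl

theorem toSeq_succ_of_notMem (b : JF.Branch) {i : ℕ} (hi : b.toSeq i ∉ JF.defined) :
    b.toSeq (i + 1) = b.toSeq i := by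
  cases b with
  | infinite s => exact absurd (s i).2 hi
  | finite l hl o =>
    rcases lt_or_ge i l.length with h | h
    · rw [toSeq_finite_of_lt h] at hi
      exact absurd (Subtype.prop _) hi
    · rw [toSeq_finite_of_le h, toSeq_finite_of_le (by omega)]

end Branch

theorem eq_of_notMem {f : ℕ → F} (hf : ∀ i, f i ∉ JF.defined → f (i + 1) = f i) {i j : ℕ}
    (hi : f i ∉ JF.defined) (hij : i ≤ j) : f j = f i := by
  induction j, hij using Nat.le_induction with
  | base => rfl
  | succ j _ ih => rw [hf j (ih ▸ hi), ih]

theorem exists_toSeq_eq {f : ℕ → F} (h0 : f 0 ∈ JF.defined)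
    (hf : ∀ i, f i ∉ JF.defined → f (i + 1) = f i) : ∃ b : JF.Branch, b.toSeq = f := by
  classical
  by_cases h : ∃ k, f k ∉ JF.defined
  · have hk := Nat.find_spec h
    have hmin : ∀ i < Nat.find h, f i ∈ JF.defined := fun i hi => not_not.1 (Nat.find_min h hi)
    generalize Nat.find h = k at hk hmin
    have hk0 : 0 < k := Nat.pos_of_ne_zero fun h => hk (h ▸ h0)
    refine ⟨.finite (List.ofFn fun i : Fin k => (⟨f i, hmin i i.2⟩ : JF.Defined))
      (by simpa using hk0.ne') ⟨f k, hk⟩, funext fun i => ?_⟩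
    rcases lt_or_ge i k with hi | hi
    · rw [Branch.toSeq_finite_of_lt (by simpa using hi)]
      simp
    · rw [Branch.toSeq_finite_of_le (by simpa using hi), eq_of_notMem hf hk hi]
  · push Not at h
    exact ⟨.infinite fun i => ⟨f i, h i⟩, rfl⟩

/-! ### The game of a justification frame -/

variable (JF) in
/-- Positions of the game: at a fact, a rule for it is chosen; at a rule, a fact in its body. -/
abbrev Position : Type u := F ⊕ JF.rules

/-- The moves of the game; the play stays in an open fact forever. -/
def Move : JF.Position → JF.Position → Prop
  | .inl x, .inl y => x = y ∧ x ∉ JF.defined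
  | .inl x, .inr r => r.1.1 = x
  | .inr r, .inl y => y ∈ r.1.2
  | .inr _, .inr _ => False

/-- The fact under consideration in a position. -/
def label : JF.Position → F := Sum.elim id fun r => r.1.1

/-- The sequence of facts occurring in a play. -/
def facts (w : ℕ → JF.Position) : ℕ → F := fun i => label (w (2 * i))

open Classical in
/-- The payoff of a play: the value of its branch, or of its open initial fact. -/
noncomputable def payoff (B : JF.BranchEvaluation) (I : Interpretation F)
    (w : ℕ → JF.Position) : Truth :=
  if h : ∃ b : JF.Branch, b.toSeq = facts w then I.val (B h.choose) else I.val (facts w 0)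

theorem payoff_eq {B : JF.BranchEvaluation} {I : Interpretation F} {w : ℕ → JF.Position}
    {b : JF.Branch} (h : b.toSeq = facts w) : payoff B I w = I.val (B b) := by
  have h' : ∃ b : JF.Branch, b.toSeq = facts w := ⟨b, h⟩
  rw [payoff, dif_pos h', Branch.toSeq_injective (h'.choose_spec.trans h.symm)]

theorem payoff_congr {B : JF.BranchEvaluation} {I : Interpretation F} {w w' : ℕ → JF.Position}
    (h : facts w = facts w') : payoff B I w = payoff B I w' := by
  rw [payoff, payoff, h]

theorem noDeadEnd_move : NoDeadEnd (Move (JF := JF)) := by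
  rintro (x | r)
  · by_cases hx : x ∈ JF.defined
    · obtain ⟨A, hA⟩ := JF.exists_rule x hx
      exact ⟨.inr ⟨_, hA⟩, rfl⟩
    · exact ⟨.inl x, rfl, hx⟩
  · obtain ⟨y, hy⟩ := JF.body_nonempty _ _ r.2
    exact ⟨.inl y, hy⟩

theorem label_inr_mem (r : JF.rules) : label (.inr r : JF.Position) ∈ JF.defined :=
  JF.head_mem _ _ r.2

theorem Move.label_eq {x : F} {s : JF.Position} (h : Move (.inl x) s) : label s = x := by
  rcases s with y | r
  · exact h.1.symm
  · exact h

theorem Move.eq_of_notMem {s s' : JF.Position} (h : Move s s') (hs : label s ∉ JF.defined) :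
    s' = s := by
  rcases s with x | r
  · rcases s' with y | r
    · exact congrArg _ h.1.symm
    · exact absurd (JF.head_mem _ _ r.2) (by rw [show r.1.1 = x from h]; exact hs)
  · exact absurd (label_inr_mem r) hs

theorem Move.isRight_iff {s s' : JF.Position} (h : Move s s') (hs : label s ∈ JF.defined) :
    s'.isRight ↔ s.isLeft := by
  rcases s with x | r <;> rcases s' with y | r'
  · exact absurd hs h.2
  · simp
  · simp
  · exact h.elim

theorem isLeft_add_two {w : ℕ → JF.Position} (hw : IsPlay Move w) {j : ℕ} (hj : (w j).isLeft) :
    (w (j + 2)).isLeft := by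
  by_cases h : label (w j) ∈ JF.defined
  · have h1 := ((hw j).isRight_iff h).2 hj
    have h2 := hw (j + 1)
    rcases h3 : w (j + 1) with x | r
    · simp [h3] at h1
    · rcases h4 : w (j + 2) with y | r'
      · rfl
      · rw [h3, show j + 1 + 1 = j + 2 from rfl, h4] at h2
        exact h2.elim
  · have h1 := (hw j).eq_of_notMem h
    rw [(hw (j + 1)).eq_of_notMem (h1 ▸ h), h1]
    exact hj

theorem isLeft_add_two_mul {w : ℕ → JF.Position} (hw : IsPlay Move w) {j : ℕ}
    (hj : (w j).isLeft) (i : ℕ) : (w (j + 2 * i)).isLeft := by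
  induction i with
  | zero => exact hj
  | succ i ih => exact isLeft_add_two hw ih

theorem label_succ_of_isLeft {w : ℕ → JF.Position} (hw : IsPlay Move w) {j : ℕ}
    (hj : (w j).isLeft) : label (w (j + 1)) = label (w j) := by
  have := hw j
  rcases h : w j with x | r
  · rw [h] at this
    exact this.label_eq
  · simp [h] at hj

theorem eq_of_label_notMem {w : ℕ → JF.Position} (hw : IsPlay Move w) {i j : ℕ}
    (hi : label (w i) ∉ JF.defined) (hij : i ≤ j) : w j = w i := by
  induction j, hij using Nat.le_induction with
  | base => rfl
  | succ j _ ih => rw [(hw j).eq_of_notMem (ih ▸ hi), ih]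

theorem facts_succ_of_notMem {w : ℕ → JF.Position} (hw : IsPlay Move w) {i : ℕ}
    (hi : facts w i ∉ JF.defined) : facts w (i + 1) = facts w i := by
  rw [facts, eq_of_label_notMem hw hi (by omega), facts]

theorem exists_toSeq_eq_facts {w : ℕ → JF.Position} (hw : IsPlay Move w)
    (h0 : label (w 0) ∈ JF.defined) : ∃ b : JF.Branch, b.toSeq = facts w :=
  exists_toSeq_eq h0 fun _ => facts_succ_of_notMem hw

/-- A move out of a fact keeps the label, so reading the odd instead of the even positions of `w`
gives the same facts. -/
theorem facts_consSeq_of_isLeft {w : ℕ → JF.Position} (hw : IsPlay Move w) (h0 : (w 0).isLeft)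
    (s : JF.Position) : facts (consSeq s w) = consSeq (label s) (facts w) := by
  funext i
  cases i with
  | zero => rfl
  | succ i =>
    have := isLeft_add_two_mul hw h0 i
    rw [zero_add] at this
    exact label_succ_of_isLeft hw this

theorem facts_consSeq_of_isRight {w : ℕ → JF.Position} (hw : IsPlay Move w) (h0 : (w 0).isRight)
    {s : JF.Position} (hs : Move s (w 0)) : facts (consSeq s w) = facts w := by
  rcases hw0 : w 0 with x | r
  · simp [hw0] at h0
  have h1 : (w 1).isLeft := by
    have := hw 0
    rw [hw0] at this
    rcases h : w (0 + 1) with y | r'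
    · exact rfl
    · rw [h] at this
      exact this.elim
  funext i
  cases i with
  | zero =>
    rcases s with x | r'
    · exact hs.label_eq.symm
    · rw [hw0] at hs
      exact hs.elim
  | succ i =>
    have := isLeft_add_two_mul hw h1 i
    have h2 := label_succ_of_isLeft hw this
    rw [show 1 + 2 * i + 1 = 2 * (i + 1) by ring] at h2
    rw [facts, facts, h2, show 2 * (i + 1) = (1 + 2 * i) + 1 by ring]
    rfl

/-! ### Monotonicity and selectivity of the payoff -/

theorem monotonePayoff {B : JF.BranchEvaluation} {I : Interpretation F} (hmono : B.IsMonotone I) :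
    MonotonePayoff Move (payoff B I) := by
  intro s w₁ w₂ h₁ h₂ h0 hs hle
  by_cases hdef : label (w₁ 0) ∈ JF.defined
  · rcases hw : w₁ 0 with y | r
    · rcases s with x | r
      · rw [hw] at hs hdef
        exact absurd hdef (hs.1 ▸ hs.2)
      · obtain ⟨b₁, hb₁⟩ := exists_toSeq_eq_facts h₁ hdef
        obtain ⟨b₂, hb₂⟩ := exists_toSeq_eq_facts h₂ (h0 ▸ hdef)
        have hy : y ∈ JF.defined := by simpa [hw, label] using hdef
        have hl₁ : (w₁ 0).isLeft := by rw [hw]; rfl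
        have hx : r.1.1 ∈ JF.defined := JF.head_mem _ _ r.2
        have hcons : ∀ {w : ℕ → JF.Position} {b : JF.Branch}, IsPlay Move w → (w 0).isLeft →
            b.toSeq = facts w → (b.prepend [⟨r.1.1, hx⟩]).toSeq = facts (consSeq (.inr r) w) := by
          intro w b hw hl hb
          rw [facts_consSeq_of_isLeft hw hl, ← hb]
          funext i
          rw [Branch.toSeq_prepend]
          cases i <;> simp [consSeq, label]
        rw [payoff_eq hb₁, payoff_eq hb₂] at hle
        rw [payoff_eq (hcons h₁ hl₁ hb₁), payoff_eq (hcons h₂ (h0 ▸ hl₁) hb₂)]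
        refine hmono b₁ b₂ ⟨y, hy⟩ _ (Subtype.ext ?_) (Subtype.ext ?_) ?_ hle
        · rw [← b₁.toSeq_zero, hb₁]; simp [facts, hw, label]
        · rw [← b₂.toSeq_zero, hb₂]; simp [facts, ← h0, hw, label]
        · rw [hw] at hs
          simp only [IsPathTo, List.singleton_append, List.isChain_pair]
          exact ⟨r.1.2, r.2, hs⟩
    · have hr : (w₁ 0).isRight := by rw [hw]; rfl
      rwa [payoff_congr (facts_consSeq_of_isRight h₁ hr hs),
        payoff_congr (facts_consSeq_of_isRight h₂ (h0 ▸ hr) (h0 ▸ hs))]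
  · have : w₁ = w₂ := funext fun i => by
      rw [eq_of_label_notMem h₁ hdef (Nat.zero_le i),
        eq_of_label_notMem h₂ (h0 ▸ hdef) (Nat.zero_le i), h0]
    rw [this]

theorem step_of_comp_move {s s' : JF.Position} (h : Relation.Comp Move Move s s')
    (hs : label s ∈ JF.defined) (hs' : label s' ∈ JF.defined) :
    JF.Step ⟨label s, hs⟩ ⟨label s', hs'⟩ := by
  obtain ⟨m, h1, h2⟩ := h
  rcases s with x | r
  · rcases m with z | r
    · exact absurd hs h1.2
    · rcases s' with y | r'
      · have hr : (x, r.1.2) ∈ JF.rules := by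
          rw [← show r.1.1 = x from h1]
          exact r.2
        exact ⟨r.1.2, hr, h2⟩
      · exact h2.elim
  · rcases m with z | r'
    · have hy : label s' ∈ r.1.2 := by
        rw [h2.label_eq]
        exact h1
      exact ⟨r.1.2, r.2, hy⟩
    · exact h1.elim

/-- Facts and rules alternate until an open fact is reached, and from then on the defined label of
`w 0` cannot recur. -/
theorem succ_ne_of_isPlay {w : ℕ → JF.Position} (hw : IsPlay Move w)
    (h0 : label (w 0) ∈ JF.defined) (i : ℕ) : w (2 * i + 1) ≠ w 0 := by
  intro h
  by_cases hdef : label (w (2 * i)) ∈ JF.defined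
  · have hiff := (hw (2 * i)).isRight_iff hdef
    rw [h] at hiff
    rcases hw0 : w 0 with x | r
    · have := isLeft_add_two_mul hw (j := 0) (by rw [hw0]; rfl) i
      rw [zero_add] at this
      rw [hw0] at hiff
      simp [this] at hiff
    · have h1 : (w 1).isLeft := by
        have := (hw 0).isRight_iff h0
        rw [hw0] at this
        simpa using this
      have := isLeft_add_two_mul hw h1 i
      rw [add_comm, h, hw0] at this
      simp at this
  · rw [(hw (2 * i)).eq_of_notMem hdef] at h
    exact hdef (h ▸ h0)

/-- The play is cut at the visits of `w 0` into loops within single subgraphs, and selectivity is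
applied to its branch. The resulting branches are traced back to plays within one subgraph. -/
theorem exists_plays_of_isSelective {B : JF.BranchEvaluation} {I : Interpretation F}
    (hsel : B.IsSelective I) {H : Bool → JF.Position → JF.Position → Prop}
    (hH : ∀ b s s', H b s s' → Move s s') {w : ℕ → JF.Position} {c : ℕ → Bool}
    (hw : ∀ i, H (c i) (w i) (w (i + 1))) (hc : ∀ i, w (i + 1) ≠ w 0 → c (i + 1) = c i) :
    (∃ (d : ℕ → JF.Position) (b : Bool), d 0 = w 0 ∧ IsPlay (H b) d ∧
      payoff B I d ≤ payoff B I w) ∧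
    ∃ (d : ℕ → JF.Position) (b : Bool), d 0 = w 0 ∧ IsPlay (H b) d ∧
      payoff B I w ≤ payoff B I d := by
  classical
  have hplay : IsPlay Move w := fun i => hH _ _ _ (hw i)
  by_cases hdef : label (w 0) ∈ JF.defined
  swap
  · have hconst : IsPlay (H (c 0)) w := fun i => by
      have := hw 0
      rw [eq_of_label_notMem hplay hdef (Nat.zero_le (0 + 1))] at this
      rwa [eq_of_label_notMem hplay hdef (Nat.zero_le (i + 1)),
        eq_of_label_notMem hplay hdef (Nat.zero_le i)]
    exact ⟨⟨w, _, rfl, hconst, le_rfl⟩, ⟨w, _, rfl, hconst, le_rfl⟩⟩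
  -- The fallback only makes `lab` total; it is used solely on positions with a defined label.
  let lab : JF.Position → JF.Defined := fun s =>
    if h : label s ∈ JF.defined then ⟨label s, h⟩ else ⟨label (w 0), hdef⟩
  have hlab : ∀ {s}, label s ∈ JF.defined → (lab s).1 = label s := fun h => by simp [lab, h]
  let R : Bool → JF.Position → JF.Position → Prop := fun b s s' =>
    Relation.Comp (H b) (H b) s s' ∧ label s ∈ JF.defined ∧ label s' ∈ JF.defined
  have hRstep : ∀ {b s s'}, R b s s' → JF.Step (lab s) (lab s') := by
    rintro b s s' ⟨⟨m, h1, h2⟩, h3, h4⟩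
    simpa [lab, h3, h4] using step_of_comp_move ⟨m, hH _ _ _ h1, hH _ _ _ h2⟩ h3 h4
  -- The loops come from cycles through the position `w 0`, not merely through its label, so that
  -- members of `M b` can be concatenated to a play in `H b`.
  let M : Bool → Set (List JF.Defined) := fun b => {q | ∃ l, IsLoopAt (R b) (w 0) l ∧ q = l.map lab}
  let K : Set JF.Branch := {b | ∃ d e, d 0 = w 0 ∧ IsPlay (H e) d ∧ b.toSeq = facts d}
  have hM : ∀ b, ∀ q ∈ M b, JF.IsLoop (lab (w 0)) q := by
    rintro b _ ⟨l, ⟨h1, h2⟩, rfl⟩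
    refine ⟨by simp [h1], ?_⟩
    have : l.map lab ++ [lab (w 0)] = (l ++ [w 0]).map lab := by simp
    rw [IsPathTo, this, List.isChain_map]
    exact h2.imp fun _ _ h => hRstep h
  have hK : ∀ b ∈ K, b.start = lab (w 0) := by
    rintro b ⟨d, e, hd0, -, hb⟩
    apply Subtype.ext
    rw [← b.toSeq_zero, hb, hlab hdef, ← hd0]
    rfl
  have hback : ∀ b ∈ omega (M true) ∪ omega (M false) ∪ K, b ∈ K := by
    have homega : ∀ e, ∀ b ∈ omega (M e), b ∈ K := by
      rintro e _ ⟨q, s, hq, hs, rfl⟩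
      choose Q hQ hqQ using hq
      obtain ⟨u, hu0, hu, hQu⟩ := exists_play_of_loops hQ
      obtain ⟨d, hd, hdu⟩ := exists_play_of_comp (H := H e) (u := u) fun i => (hu i).1
      refine ⟨d, e, (hdu 0).trans hu0, hd, funext fun i => ?_⟩
      have hlen : i < ((List.range (i + 1)).flatMap Q).length := by
        have : ∀ n, n ≤ ((List.range n).flatMap Q).length := fun n => by
          induction n with
          | zero => omega
          | succ n ih =>
            rw [List.range_succ, List.flatMap_append, List.flatMap_singleton, List.length_append]
            have : 0 < (Q n).length := List.length_pos_iff.2 fun h => by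
              have := (hQ n).1
              simp [h] at this
            omega
        exact this (i + 1)
      have hflat : (List.range (i + 1)).flatMap q = ((List.range (i + 1)).flatMap Q).map lab := by
        rw [List.map_flatMap]
        exact congrArg (fun g => List.flatMap g (List.range (i + 1))) (funext hqQ)
      have h1 := hs (i + 1)
      rw [hflat] at h1
      have h2 := congrArg (fun l => l[i]?) h1
      simp only [List.getElem?_map, List.length_map, List.getElem?_range hlen,
        List.getElem?_eq_getElem hlen, Option.map_some, Option.some_inj, hQu] at h2
      rw [facts, hdu, ← hlab (hu i).2.1, ← h2]
      rfl
    rintro b ((hb | hb) | hb)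
    · exact homega _ b hb
    · exact homega _ b hb
    · exact hb
  obtain ⟨b, hb⟩ := exists_toSeq_eq_facts hplay hdef
  have hmem : b ∈ Set.image2 Branch.prepend (star (M true ∪ M false)) K ∪
      omega (M true ∪ M false) := by
    -- Odd places never visit `w 0`, so both halves of a double step lie in the same subgraph.
    have hodd : ∀ i, c (2 * i + 1) = c (2 * i) := fun i =>
      hc _ (succ_ne_of_isPlay hplay hdef i)
    have hmode : ∀ i, w (2 * (i + 1)) ≠ w (2 * 0) → c (2 * (i + 1)) = c (2 * i) := fun i hi => by
      rw [← hodd i]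
      exact hc (2 * i + 1) hi
    have hcomp : ∀ i, Relation.Comp (H (c (2 * i))) (H (c (2 * i))) (w (2 * i))
        (w (2 * (i + 1))) := fun i => by
      refine ⟨w (2 * i + 1), hw _, ?_⟩
      have := hw (2 * i + 1)
      rwa [hodd] at this
    have hunion : ∀ {l}, (∃ e, IsLoopAt (R e) (w 0) l) → l.map lab ∈ M true ∪ M false := by
      rintro l ⟨e, hl⟩
      cases e
      · exact Or.inr ⟨l, hl, rfl⟩
      · exact Or.inl ⟨l, hl, rfl⟩
    have hdefle : ∀ {n i}, w (2 * n) = w 0 → i ≤ n → label (w (2 * i)) ∈ JF.defined := by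
      intro n i hn hi
      by_contra h
      rw [← hn, eq_of_label_notMem hplay h (by omega)] at hdef
      exact h hdef
    by_cases hvis : ∀ n, ∃ m, n < m ∧ w (2 * m) = w (2 * 0)
    · right
      have hall : ∀ i, label (w (2 * i)) ∈ JF.defined := fun i => by
        obtain ⟨m, him, hm⟩ := hvis i
        exact hdefle hm him.le
      obtain ⟨Q, hQ, hQu⟩ := exists_loops_of_frequent_visits (R := R) (u := fun i => w (2 * i))
        (c := fun i => c (2 * i)) hmode hvis fun i => ⟨hcomp i, hall i, hall (i + 1)⟩
      refine ⟨fun n => (Q n).map lab, fun i => lab (w (2 * i)), fun n => hunion (hQ n),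
        fun n => ?_, Branch.toSeq_injective (hb.trans (funext fun i => ?_))⟩
      · obtain ⟨k, hk⟩ := hQu n
        rw [← List.map_flatMap, hk]
        simp
      · exact (hlab (hall i)).symm
    · left
      push Not at hvis
      obtain ⟨N, hN⟩ := hvis
      -- After the last visit, at place `2 * n`, the mode is constant, so the tail is a member of
      -- `K` preceded by finitely many loops.
      let n := Nat.findGreatest (fun i => w (2 * i) = w 0) N
      have hn : w (2 * n) = w 0 :=
        Nat.findGreatest_spec (P := fun i => w (2 * i) = w 0) (Nat.zero_le N) rfl
      have hlast : ∀ m, n < m → w (2 * m) ≠ w 0 := fun m hm => by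
        rcases le_or_gt m N with h | h
        · exact Nat.findGreatest_is_greatest hm h
        · exact hN m h
      obtain ⟨Q, hQ, hQu⟩ := exists_loops_of_visit (R := R) (u := fun i => w (2 * i))
        (c := fun i => c (2 * i)) hmode n hn fun i hi =>
          ⟨hcomp i, hdefle hn hi.le, hdefle hn hi⟩
      have hshift : IsPlay Move fun i => w (i + 2 * n) := hplay.shift _
      obtain ⟨b', hb'⟩ := exists_toSeq_eq_facts hshift (by simpa [hn] using hdef)
      refine ⟨(List.range n).map fun i => lab (w (2 * i)), ⟨Q.map (List.map lab), ?_, ?_⟩, b',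
        ⟨_, c (2 * n), by simpa using hn, fun i => ?_, hb'⟩, Branch.toSeq_injective ?_⟩
      · intro q hq
        obtain ⟨l, hl, rfl⟩ := List.mem_map.1 hq
        exact hunion (hQ l hl)
      · rw [← List.map_flatten, ← hQu]
        simp
      · have hcc : ∀ i, c (i + 2 * n) = c (2 * n) := fun i => by
          induction i with
          | zero => simp
          | succ i ih =>
            rw [← ih, show i + 1 + 2 * n = i + 2 * n + 1 by omega]
            apply hc
            rcases Nat.even_or_odd' (i + 2 * n) with ⟨k, hk | hk⟩
            · rw [hk]
              exact succ_ne_of_isPlay hplay hdef k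
            · rw [hk]
              exact hlast (k + 1) (by omega)
        have := hw (i + 2 * n)
        rw [hcc] at this
        simpa only [show i + 1 + 2 * n = i + 2 * n + 1 by omega] using this
      · rw [hb]
        funext i
        rw [Branch.toSeq_prepend, hb']
        split_ifs with hi
        · simp only [List.length_map, List.length_range] at hi
          simp [hlab (hdefle hn hi.le), facts]
        · simp only [List.length_map, List.length_range] at hi
          simp [facts, show 2 * (i - n) + 2 * n = 2 * i by omega]
  -- The empty prefix suffices: the part of a play before its first visit of the split position is
  -- handled by monotonicity.
  obtain ⟨c₁, hc₁, c₂, hc₂, hle₁, hle₂⟩ := hsel [] (lab (w 0)) (by simp [IsPathTo]) (M true)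
    (M false) K (hM true) (hM false) hK b hmem
  simp only [Branch.prepend_nil] at hle₁ hle₂
  obtain ⟨d₁, e₁, hd₁0, hd₁, hcd₁⟩ := hback c₁ hc₁
  obtain ⟨d₂, e₂, hd₂0, hd₂, hcd₂⟩ := hback c₂ hc₂
  rw [payoff_eq hb]
  exact ⟨⟨d₁, e₁, hd₁0, hd₁, by rwa [payoff_eq hcd₁]⟩, ⟨d₂, e₂, hd₂0, hd₂, by rwa [payoff_eq hcd₂]⟩⟩

theorem selectivePayoff {B : JF.BranchEvaluation} {I : Interpretation F} (hsel : B.IsSelective I) :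
    SelectivePayoff Move (payoff B I) :=
  fun _ hH _ _ hw hc => (exists_plays_of_isSelective hsel hH hw hc).2

theorem selectivePayoff_dual {B : JF.BranchEvaluation} {I : Interpretation F}
    (hsel : B.IsSelective I) : SelectivePayoff Move (OrderDual.toDual ∘ payoff B I) :=
  fun _ hH _ _ hw hc => (exists_plays_of_isSelective hsel hH hw hc).1

end JustificationFrame

namespace Truth

theorem neg_neg (a : Truth) : a.neg.neg = a := by cases a <;> rfl

theorem neg_le_neg {a b : Truth} (h : a ≤ b) : b.neg ≤ a.neg := by
  have h' : a.rank ≤ b.rank := h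
  show b.neg.rank ≤ a.neg.rank
  cases a <;> cases b <;> simp_all [rank, neg]

end Truth

/-! ### Unravelling a graph into a forest -/

namespace LabelledGraph

variable {F : Type u}

/-- The forest of paths of a labelled graph: a node is a node of the graph with a list of
predecessors. -/
def unravel (J : LabelledGraph F) : LabelledGraph F where
  Node := J.Node × List J.Node
  edge a b := J.edge a.1 b.1 ∧ b.2 = a.1 :: a.2
  label a := J.label a.1

/-- A child in the unravelling records its parent's history, so every edge of `J` lifts uniquely
from a given node. -/
theorem isInternal_unravel {J : LabelledGraph F} {a : J.unravel.Node} :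
    J.unravel.IsInternal a ↔ J.IsInternal a.1 :=
  ⟨fun ⟨b, hb⟩ => ⟨b.1, hb.1⟩, fun ⟨m, hm⟩ => ⟨(m, a.1 :: a.2), hm, rfl⟩⟩

theorem isForest_unravel (J : LabelledGraph F) : J.unravel.IsForest := by
  have hanti : ∀ n m, J.unravel.edge n m → ¬ J.unravel.edge m n := by
    rintro n m ⟨-, h1⟩ ⟨-, h2⟩
    have h1' := congrArg List.length h1
    have h2' := congrArg List.length h2
    simp only [List.length_cons] at h1' h2'
    omega
  refine ⟨?_, hanti⟩
  -- Every edge is a bridge: without the edge from `a` to `b`, a walk from `b` stays among nodes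
  -- whose history extends that of `b`, because the only step leaving them is from `b` back to `a`.
  -- The history of `a` is too short.
  have hbridge : ∀ a b, J.unravel.edge a b →
      ¬ ((SimpleGraph.fromRel J.unravel.edge).deleteEdges {s(a, b)}).Reachable b a := by
    rintro a b ⟨-, hab⟩ ⟨p⟩
    have hinv : ∀ x y, ((SimpleGraph.fromRel J.unravel.edge).deleteEdges {s(a, b)}).Walk x y →
        (b.1 :: b.2) <:+ (x.1 :: x.2) → (b.1 :: b.2) <:+ (y.1 :: y.2) := by
      intro x y q
      induction q with
      | nil => exact id
      | @cons x z y hxz _ ih =>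
        refine fun hx => ih ?_
        rw [SimpleGraph.deleteEdges_adj, SimpleGraph.fromRel_adj] at hxz
        obtain ⟨⟨-, h | h⟩, hne⟩ := hxz
        · rw [h.2]
          exact hx.trans (List.suffix_cons _ _)
        · rw [← h.2]
          rcases List.suffix_cons_iff.1 hx with hx | hx
          · exfalso
            apply hne
            have hxb : x = b := by
              injection hx with h1 h2
              exact Prod.ext h1.symm h2.symm
            subst hxb
            have hza : z = a := by
              have := h.2.symm.trans hab
              injection this with h1 h2
              exact Prod.ext h1 h2
            rw [hza, Set.mem_singleton_iff, Sym2.eq_swap]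
          · exact hx
    have := (hinv b a p List.suffix_rfl).length_le
    rw [List.length_cons, List.length_cons, hab, List.length_cons] at this
    omega
  rw [SimpleGraph.isAcyclic_iff_forall_adj_isBridge]
  intro a b hab
  rw [SimpleGraph.isBridge_iff]
  rw [SimpleGraph.fromRel_adj] at hab
  rcases hab.2 with h | h
  · exact fun hr => hbridge a b h hr.symm
  · rw [Sym2.eq_swap]
    exact hbridge b a h

end LabelledGraph

namespace JustificationFrame

variable {F : Type u} [FactSpace F] {JF : JustificationFrame F}

open PositionalGame

/-! ### Branches of justifications -/

theorem IsBranchOf.toSeq_zero {J : LabelledGraph F} {x : F} {b : JF.Branch}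
    (h : JF.IsBranchOf J x b) : b.toSeq 0 = x := by
  rw [b.toSeq_zero]
  cases b <;> exact h.1

theorem IsBranchOf.exists_edge {J : LabelledGraph F} {x : F} {b : JF.Branch}
    (h : JF.IsBranchOf J x b) {i : ℕ} (hi : b.toSeq i ∈ JF.defined) :
    ∃ n m, J.edge n m ∧ J.label n = b.toSeq i ∧ J.label m = b.toSeq (i + 1) := by
  cases b with
  | infinite s =>
    obtain ⟨-, ns, hedge, hlabel⟩ := h
    exact ⟨ns i, ns (i + 1), hedge i, hlabel i, hlabel (i + 1)⟩
  | finite l hl o =>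
    obtain ⟨-, ns, m, hchain, -, hns, hm⟩ := h
    have hlen : ns.length = l.length := by simpa using congrArg List.length hns
    have hil : i < l.length := by
      by_contra h
      rw [Branch.toSeq_finite_of_le (not_lt.1 h)] at hi
      exact o.2 hi
    have hall : (ns ++ [m]).map J.label = l.map Subtype.val ++ [o.1] := by simp [hns, hm]
    have hlab : ∀ j (hj : j < (ns ++ [m]).length),
        J.label (ns ++ [m])[j] = (Branch.finite l hl o).toSeq j := by
      intro j hj
      have h1 : J.label (ns ++ [m])[j] = ((ns ++ [m]).map J.label)[j]'(by simpa using hj) := by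
        rw [List.getElem_map]
      rw [h1]
      simp only [hall]
      simp only [List.length_append, List.length_singleton] at hj
      rcases lt_or_ge j l.length with h | h
      · rw [Branch.toSeq_finite_of_lt h, List.getElem_append_left (by simpa using h)]
        simp
      · rw [Branch.toSeq_finite_of_le h, List.getElem_append_right (by simpa using h)]
        simp
    have h1 := List.isChain_iff_getElem.1 hchain i (by simp; omega)
    exact ⟨_, _, h1, hlab _ _, hlab _ _⟩

theorem isBranchOf_of_seq {J : LabelledGraph F} (hJ : JF.IsJustification J) {b : JF.Branch}
    {ns : ℕ → J.Node} (hb : ∀ i, b.toSeq i = J.label (ns i))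
    (hns : ∀ i, J.label (ns i) ∈ JF.defined → J.edge (ns i) (ns (i + 1))) :
    JF.IsBranchOf J (J.label (ns 0)) b := by
  have h0 := hb 0
  rw [b.toSeq_zero] at h0
  cases b with
  | infinite s => exact ⟨h0, ns, fun i => hns i (hb i ▸ (s i).2), fun i => (hb i).symm⟩
  | finite l hl o =>
    have hlt : ∀ i (hi : i < l.length), l[i].1 = J.label (ns i) := fun i hi => by
      rw [← hb, Branch.toSeq_finite_of_lt hi]
    have hlast : J.label (ns l.length) = o.1 := by
      rw [← hb, Branch.toSeq_finite_of_le le_rfl]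
    refine ⟨h0, (List.range l.length).map ns, ns l.length, ?_, ?_, ?_, hlast⟩
    · have : (List.range l.length).map ns ++ [ns l.length] = (List.range (l.length + 1)).map ns := by
        simp [List.range_succ]
      rw [this, List.isChain_iff_getElem]
      intro i hi
      simp only [List.length_map, List.length_range] at hi
      simpa using hns i (by rw [← hlt i (by omega)]; exact Subtype.prop _)
    -- The label of an internal node heads a rule, so a node with an open label is a leaf.
    · intro hint
      exact o.2 (hlast ▸ JF.head_mem _ _ (hJ _ hint))
    · refine List.ext_getElem (by simp) fun i hi hi' => ?_
      simp only [List.length_map] at hi'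
      simp [hlt i hi']

theorem isInternal_of_mem {J : LabelledGraph F} (hJ : JF.IsLocallyComplete J) {n : J.Node}
    (hn : J.label n ∈ JF.defined) : J.IsInternal n :=
  by_contra fun h => hJ n h hn

/-- Justifications of complementary facts have complementary branches. -/
theorem exists_common_branch (hopp : JF.HasOpposedRules) {J J' : LabelledGraph F}
    (hJ : JF.IsJustification J) (hJc : JF.IsLocallyComplete J) (hJ' : JF.IsJustification J')
    (hJc' : JF.IsLocallyComplete J') {n : J.Node} {n' : J'.Node} (hn : J.label n ∈ JF.defined)
    (hn' : J'.label n' = FactSpace.compl (J.label n)) :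
    ∃ b, JF.IsBranchOf J (J.label n) b ∧ JF.IsBranchOf J' (J'.label n') b.compl := by
  -- Two nodes with complementary labels have children with complementary labels, by opposedness of
  -- their rules. At an open fact the pair stays put, matching the padding in `toSeq`.
  have hstep : ∀ p : {p : J.Node × J'.Node // J'.label p.2 = FactSpace.compl (J.label p.1)},
      ∃ q : {p : J.Node × J'.Node // J'.label p.2 = FactSpace.compl (J.label p.1)},
        (J.label p.1.1 ∈ JF.defined → J.edge p.1.1 q.1.1 ∧ J'.edge p.1.2 q.1.2) ∧
        (J.label p.1.1 ∉ JF.defined → q = p) := by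
    rintro ⟨⟨a, a'⟩, ha⟩
    dsimp only at ha
    by_cases hdef : J.label a ∈ JF.defined
    · have h1 := hJ a (isInternal_of_mem hJc hdef)
      have hdef' : J'.label a' ∈ JF.defined := ha ▸ JF.compl_mem _ hdef
      have h2 := hJ' a' (isInternal_of_mem hJc' hdef')
      rw [ha] at h2
      obtain ⟨_, ⟨m, hm, rfl⟩, ⟨_, ⟨m', hm', rfl⟩, hz⟩⟩ := hopp _ _ _ h1 h2
      refine ⟨⟨(m, m'), ?_⟩, fun _ => ⟨hm, hm'⟩, fun h => absurd hdef h⟩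
      dsimp only
      rw [← hz, FactSpace.compl_compl]
    · exact ⟨_, fun h => absurd h hdef, fun _ => rfl⟩
  choose f hf hf' using hstep
  obtain ⟨q, hq0, hq⟩ := exists_seq_of_step (f := f) ⟨(n, n'), hn'⟩
  have h0 : (q 0).1 = (n, n') := by rw [hq0]
  obtain ⟨b, hb⟩ := exists_toSeq_eq (JF := JF) (f := fun i => J.label (q i).1.1)
    (by simpa [h0] using hn) fun i hi => by rw [hq, hf' _ hi]
  refine ⟨b, ?_, ?_⟩
  · have := isBranchOf_of_seq hJ (b := b) (ns := fun i => (q i).1.1) (fun i => congrFun hb i)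
      fun i hi => by rw [hq]; exact (hf _ hi).1
    simpa [h0] using this
  · have := isBranchOf_of_seq hJ' (b := b.compl) (ns := fun i => (q i).1.2)
      (fun i => by rw [Branch.toSeq_compl, hb, (q i).2]) fun i hi => by
        rw [hq]
        refine (hf _ ?_).2
        have := JF.compl_mem _ hi
        rwa [(q i).2, FactSpace.compl_compl] at this
    simpa [h0] using this

/-! ### Supported values -/

theorem treeSupportedValue_le_neg (hopp : JF.HasOpposedRules) {B : JF.BranchEvaluation}
    (hcons : B.IsConsistent) (I : Interpretation F) {x : F} (hx : x ∈ JF.defined) :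
    JF.treeSupportedValue B x I ≤ (JF.treeSupportedValue B (FactSpace.compl x) I).neg := by
  rw [treeSupportedValue, if_pos hx, treeSupportedValue, if_pos (JF.compl_mem x hx)]
  apply sSup_le
  rintro _ ⟨J, hJ, hJc, ⟨n, rfl⟩, rfl⟩
  rw [← Truth.neg_neg (JF.justValue B J _ I)]
  apply Truth.neg_le_neg
  apply sSup_le
  rintro _ ⟨J', hJ', hJc', ⟨n', hn'⟩, rfl⟩
  -- The common branch bounds one value by `I (B b)` and, by consistency, the other by its negation.
  obtain ⟨b, hb, hb'⟩ := exists_common_branch hopp hJ.1 hJc hJ'.1 hJc' hx hn'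
  rw [hn'] at hb'
  have h1 : JF.justValue B J (J.label n) I ≤ I.val (B b) := sInf_le ⟨b, hb, rfl⟩
  have h2 : JF.justValue B J' (FactSpace.compl (J.label n)) I ≤ I.val (B b.compl) :=
    sInf_le ⟨_, hb', rfl⟩
  rw [hcons, I.val_compl] at h2
  exact h2.trans (Truth.neg_le_neg h1)

theorem isJustification_unravel {J : LabelledGraph F} (hJ : JF.IsJustification J) :
    JF.IsJustification J.unravel := by
  intro a ha
  have hset : {y | ∃ b, J.unravel.edge a b ∧ y = J.unravel.label b} =
      {y | ∃ m, J.edge a.1 m ∧ y = J.label m} := by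
    ext y
    constructor
    · rintro ⟨b, hb, rfl⟩
      exact ⟨b.1, hb.1, rfl⟩
    · rintro ⟨m, hm, rfl⟩
      exact ⟨(m, a.1 :: a.2), ⟨hm, rfl⟩, rfl⟩
  rw [hset]
  exact hJ a.1 (LabelledGraph.isInternal_unravel.1 ha)

theorem IsBranchOf.of_unravel {J : LabelledGraph F} {x : F} {b : JF.Branch}
    (h : JF.IsBranchOf J.unravel x b) : JF.IsBranchOf J x b := by
  cases b with
  | infinite s =>
    obtain ⟨h0, ns, h1, h2⟩ := h
    exact ⟨h0, fun i => (ns i).1, fun i => (h1 i).1, h2⟩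
  | finite l hl o =>
    obtain ⟨h0, ns, m, h1, h2, h3, h4⟩ := h
    let π : J.unravel.Node → J.Node := fun a => a.1
    refine ⟨h0, ns.map π, π m, ?_, fun h => h2 (LabelledGraph.isInternal_unravel.2 h), ?_, h4⟩
    · have : ns.map π ++ [π m] = (ns ++ [m]).map π := by simp
      rw [this, List.isChain_map]
      exact h1.imp fun _ _ h => h.1
    · rw [← h3, List.map_map]
      rfl

theorem graphSupportedValue_le_treeSupportedValue (B : JF.BranchEvaluation) (I : Interpretation F)
    (x : F) : JF.graphSupportedValue B x I ≤ JF.treeSupportedValue B x I := by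
  by_cases hx : x ∈ JF.defined
  · rw [treeSupportedValue, if_pos hx, graphSupportedValue, if_pos hx]
    apply sSup_le
    rintro _ ⟨J, hJ, hJc, ⟨n, hn⟩, rfl⟩
    refine le_sSup_of_le ⟨J.unravel, ⟨isJustification_unravel hJ.1, J.isForest_unravel⟩,
      fun a ha => hJc a.1 fun h => ha (LabelledGraph.isInternal_unravel.2 h), ⟨(n, []), hn⟩, rfl⟩ ?_
    apply le_sInf
    rintro _ ⟨b, hb, rfl⟩
    exact sInf_le ⟨b, hb.of_unravel, rfl⟩
  · rw [treeSupportedValue, if_neg hx, graphSupportedValue, if_neg hx]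

/-- A positional strategy choosing rules yields a graph-like justification. -/
theorem le_graphSupportedValue_of_positional {B : JF.BranchEvaluation} {I : Interpretation F}
    {v : JF.Position → Truth} (h : Positional (fun s => s.isLeft = true) Move (payoff B I) v)
    {x : F} (hx : x ∈ JF.defined) : v (.inl x) ≤ JF.graphSupportedValue B x I := by
  obtain ⟨σ, hσ, hval⟩ := h
  have hσrule : ∀ y ∈ JF.defined, ∃ r : JF.rules, σ (.inl y) = .inr r ∧ r.1.1 = y := by
    intro y hy
    have := hσ (.inl y)
    rcases hs : σ (.inl y) with z | r
    · rw [hs] at this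
      exact absurd hy this.2
    · rw [hs] at this
      exact ⟨r, rfl, this⟩
  let J : LabelledGraph F :=
    ⟨F, fun y z => y ∈ JF.defined ∧ ∃ r : JF.rules, σ (.inl y) = .inr r ∧ z ∈ r.1.2, id⟩
  have hJ : JF.IsJustification J := by
    rintro n ⟨_, hn, -⟩
    obtain ⟨r, hr, hrn⟩ := hσrule n hn
    have hset : {y | ∃ m, J.edge n m ∧ y = J.label m} = r.1.2 := by
      ext y
      constructor
      · rintro ⟨m, ⟨-, r', hr', hm⟩, rfl⟩
        rw [hr] at hr'
        rw [Sum.inr.inj hr']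
        exact hm
      · exact fun hy => ⟨y, ⟨hn, r, hr, hy⟩, rfl⟩
    rw [hset, show J.label n = r.1.1 from hrn.symm]
    exact r.2
  have hJc : JF.IsLocallyComplete J := by
    intro n hleaf hn
    obtain ⟨r, hr, -⟩ := hσrule n hn
    obtain ⟨y, hy⟩ := JF.body_nonempty _ _ r.2
    exact hleaf ⟨y, hn, r, hr, hy⟩
  rw [graphSupportedValue, if_pos hx]
  refine le_sSup_of_le ⟨J, ⟨hJ, Function.injective_id⟩, hJc, ⟨x, rfl⟩, rfl⟩ (le_sInf ?_)
  rintro _ ⟨b, hb, rfl⟩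
  -- Inserting the rules chosen by `σ` between the facts of a branch of `J` gives a play that
  -- follows `σ`.
  obtain ⟨w, hw, hwb⟩ := exists_play_of_comp
    (H := fun s s' : JF.Position => Move s s' ∧ (s.isLeft = true → s' = σ s))
    (u := fun i => .inl (b.toSeq i)) fun i => by
      dsimp only
      refine ⟨σ (.inl (b.toSeq i)), ⟨hσ _, fun _ => rfl⟩, ?_⟩
      by_cases hi : b.toSeq i ∈ JF.defined
      · obtain ⟨n, m, ⟨-, r, hr, hm⟩, hn, hm'⟩ := hb.exists_edge hi
        rw [← hn, ← hm', show σ (.inl (J.label n)) = .inr r from hr]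
        exact ⟨hm, by simp⟩
      · have := (hσ (.inl (b.toSeq i))).eq_of_notMem hi
        rw [b.toSeq_succ_of_notMem hi, this]
        exact ⟨⟨rfl, hi⟩, fun _ => this.symm⟩
  have hle := hval w (fun i => (hw i).1) (fun i => (hw i).2)
  have hfacts : b.toSeq = facts w := funext fun i => by rw [facts, hwb]; rfl
  rwa [payoff_eq hfacts, ← Nat.mul_zero 2, hwb, hb.toSeq_zero] at hle

/-- A positional strategy choosing facts in bodies of rules yields a graph-like justification
consisting of complementary rules. -/
theorem neg_le_graphSupportedValue_of_positional (hcompl : JF.IsComplementary)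
    {B : JF.BranchEvaluation} (hcons : B.IsConsistent) {I : Interpretation F}
    {v : JF.Position → Truth} (h : Positional (fun s => s.isRight = true) Move
      (OrderDual.toDual ∘ payoff B I) (OrderDual.toDual ∘ v))
    {x : F} (hx : x ∈ JF.defined) :
    (v (.inl (FactSpace.compl x))).neg ≤ JF.graphSupportedValue B x I := by
  classical
  obtain ⟨τ, hτ, hval⟩ := h
  have hτfact : ∀ r : JF.rules, ∃ y, τ (.inr r) = .inl y ∧ y ∈ r.1.2 := by
    intro r
    have := hτ (.inr r)
    rcases hs : τ (.inr r) with y | r'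
    · rw [hs] at this
      exact ⟨y, rfl, this⟩
    · rw [hs] at this
      exact this.elim
  choose g hg hgmem using hτfact
  -- The children of `y` are the complements of the facts that `τ` picks from the rules for `∼y`.
  let J : LabelledGraph F := ⟨F, fun y z => y ∈ JF.defined ∧
    ∃ r : JF.rules, r.1.1 = FactSpace.compl y ∧ z = FactSpace.compl (g r), id⟩
  have hJ : JF.IsJustification J := by
    rintro n ⟨_, hn, -⟩
    -- The value `n` outside the cases of `∼n` is irrelevant.
    let s : Set F → F := fun A =>
      if h : (FactSpace.compl n, A) ∈ JF.rules then g ⟨_, h⟩ else n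
    have hmem : (FactSpace.compl (FactSpace.compl n),
        FactSpace.compl '' (s '' JF.cases (FactSpace.compl n))) ∈ JF.rules := by
      rw [← show _ = _ from hcompl]
      refine Or.inr ⟨_, JF.compl_mem n hn, s, fun A hA => ?_, rfl⟩
      have hA' : (FactSpace.compl n, A) ∈ JF.rules := hA
      simpa only [s, dif_pos hA'] using hgmem ⟨_, hA'⟩
    rw [FactSpace.compl_compl] at hmem
    have hset : {y | ∃ m, J.edge n m ∧ y = J.label m} =
        FactSpace.compl '' (s '' JF.cases (FactSpace.compl n)) := by
      ext y
      constructor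
      · rintro ⟨_, ⟨-, ⟨⟨z, A⟩, hr⟩, hrn, rfl⟩, rfl⟩
        dsimp only at hrn
        subst hrn
        exact ⟨_, ⟨A, hr, dif_pos hr⟩, rfl⟩
      · rintro ⟨_, ⟨A, hA, rfl⟩, rfl⟩
        have hA' : (FactSpace.compl n, A) ∈ JF.rules := hA
        refine ⟨_, ⟨hn, ⟨_, hA'⟩, rfl, rfl⟩, ?_⟩
        simp only [s, dif_pos hA']
        rfl
    rw [hset]
    exact hmem
  have hJc : JF.IsLocallyComplete J := by
    intro n hleaf hn
    obtain ⟨A, hA⟩ := JF.exists_rule _ (JF.compl_mem n hn)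
    exact hleaf ⟨_, hn, ⟨_, hA⟩, rfl, rfl⟩
  rw [graphSupportedValue, if_pos hx]
  refine le_sSup_of_le ⟨J, ⟨hJ, Function.injective_id⟩, hJc, ⟨x, rfl⟩, rfl⟩ (le_sInf ?_)
  rintro _ ⟨b, hb, rfl⟩
  -- It is the complement of a branch of `J` that is traced by a play following `τ`; consistency
  -- converts the upper bound on its payoff into a lower bound for the branch itself.
  obtain ⟨w, hw, hwb⟩ := exists_play_of_comp
    (H := fun s s' : JF.Position => Move s s' ∧ (s.isRight = true → s' = τ s))
    (u := fun i => .inl (b.compl.toSeq i)) fun i => by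
      dsimp only
      by_cases hi : b.toSeq i ∈ JF.defined
      · obtain ⟨n, m, ⟨-, r, hr, hm⟩, hn, hm'⟩ := hb.exists_edge hi
        have hnext : b.compl.toSeq (i + 1) = g r := by
          rw [Branch.toSeq_compl, ← hm', show J.label m = _ from hm, FactSpace.compl_compl]
        refine ⟨.inr r, ⟨?_, by simp⟩, ?_, fun _ => ?_⟩
        · rw [Branch.toSeq_compl, ← hn]
          exact hr
        · rw [hnext]
          exact hgmem r
        · rw [hnext, hg]
      · have hi' : b.compl.toSeq i ∉ JF.defined := fun h => hi (by
          have := JF.compl_mem _ h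
          rwa [Branch.toSeq_compl, FactSpace.compl_compl] at this)
        rw [b.compl.toSeq_succ_of_notMem hi']
        exact ⟨.inl (b.compl.toSeq i), ⟨⟨rfl, hi'⟩, by simp⟩, ⟨rfl, hi'⟩, by simp⟩
  have hle : payoff B I w ≤ v (w 0) := hval w (fun i => (hw i).1) (fun i => (hw i).2)
  have hfacts : b.compl.toSeq = facts w := funext fun i => by rw [facts, hwb]; rfl
  rw [payoff_eq hfacts, ← Nat.mul_zero 2, hwb, Branch.toSeq_compl, hb.toSeq_zero, hcons,
    I.val_compl] at hle
  have := Truth.neg_le_neg hle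
  rwa [Truth.neg_neg] at this

end JustificationFrame

/-! ### The corollary -/

open PositionalGame JustificationFrame

theorem mainTheorem2 {F : Type u} [FactSpace F] [Finite F] (JF : JustificationFrame F)
    (hcompl : JF.IsComplementary) (hopp : JF.HasOpposedRules)
    (B : JF.BranchEvaluation) (hcons : B.IsConsistent)
    (I : Interpretation F) (hmono : B.IsMonotone I) (hsel : B.IsSelective I) :
    (∀ x ∈ JF.defined, JF.graphSupportedValue B (FactSpace.compl x) I =
      (JF.graphSupportedValue B x I).neg) ∧
    (∀ x, JF.graphSupportedValue B x I = JF.treeSupportedValue B x I) := by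
  obtain ⟨v, hv, hv'⟩ := exists_positional (own := fun s : JF.Position => s.isLeft = true)
    (opp := fun s => s.isRight = true) (fun s => by simp) (monotonePayoff hmono)
    (selectivePayoff hsel) (selectivePayoff_dual hsel) Move (fun _ _ h => h) noDeadEnd_move
  have hle : ∀ x, JF.graphSupportedValue B x I ≤ JF.treeSupportedValue B x I :=
    graphSupportedValue_le_treeSupportedValue B I
  -- Determinacy enters here: the same `v x` bounds `∼SV_g (∼x)` from above and `SV_g x` from below.
  have hup : ∀ x ∈ JF.defined, (JF.graphSupportedValue B (FactSpace.compl x) I).neg ≤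
      JF.graphSupportedValue B x I := by
    intro x hx
    have h1 := neg_le_graphSupportedValue_of_positional hcompl hcons hv' (JF.compl_mem x hx)
    rw [FactSpace.compl_compl] at h1
    have h2 := Truth.neg_le_neg h1
    rw [Truth.neg_neg] at h2
    exact h2.trans (le_graphSupportedValue_of_positional hv hx)
  have hdown : ∀ x ∈ JF.defined, JF.treeSupportedValue B x I ≤
      (JF.graphSupportedValue B (FactSpace.compl x) I).neg := fun x hx =>
    (treeSupportedValue_le_neg hopp hcons I hx).trans (Truth.neg_le_neg (hle _))
  refine ⟨fun x hx => ?_, fun x => ?_⟩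
  · rw [← le_antisymm (hup x hx) ((hle x).trans (hdown x hx)), Truth.neg_neg]
  · by_cases hx : x ∈ JF.defined
    · exact le_antisymm (hle x) ((hdown x hx).trans (hup x hx))
    · rw [graphSupportedValue, if_neg hx, treeSupportedValue, if_neg hx]
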